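/- Let $n\ge 1$, $1<p\le q<\infty$ and $1/p+1/p'=1$. For $0<r<\infty$ write $\|h\|_{L_{r,\infty}(\mathbb R^n)}=\sup_{t>0} t\,|\{x\in\mathbb R^n:|h(x)|>t\}|^{1/r}$, and let $L_{r,\infty}(\mathbb R^n)$ be the class of measurable functions for which this is finite; $*$ denotes convolution on $\mathbb R^n$. (a) Let $1<r_k<\infty$ for $k=1,2,3$, with $\frac1q+\frac1{p'}=\sum_{k=1}^3\frac1{r_k}$, $r_1>q$ and $r_3>p'$. Then there is a constant $C$, depending only on $n,p,q$ and the $r_k$, such that for all $g_k\in L_{r_k,\infty}(\mathbb R^n)$ and $f\in L^p(\mathbb R^n)$ the integral defining $g_2*(g_3f)$ converges absolutely almost everywhere and $$\|g_1(g_2*(g_3f))\|_{L^q(\mathbb R^n)}\le C\prod_{k=1}^3\|g_k\|_{L_{r_k,\infty}(\mathbb R^n)}\,\|f\|_{L^p(\mathbb R^n)}.$$ (b) Let $1<q_k<\infty$ for $k=1,2,3,4$, with $1+\frac1q+\frac1{p'}=\sum_{k=1}^4\frac1{q_k}$, $q_1<q$, $q_4>p'$ and $\frac1{q_3}+\frac1{q_4}>\frac1{p'}$.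 Then there is a constant $C$, depending only on $n,p,q$ and the $q_k$, such that for all $h_k\in L_{q_k,\infty}(\mathbb R^n)$ and $f\in L^p(\mathbb R^n)$ the integrals defining $h_3*(h_4f)$ and $h_1*\big[h_2\,(h_3*(h_4f))\big]$ converge absolutely almost everywhere and $$\big\|h_1*\big[h_2\,(h_3*(h_4f))\big]\big\|_{L^q(\mathbb R^n)}\le C\prod_{k=1}^4\|h_k\|_{L_{q_k,\infty}(\mathbb R^n)}\,\|f\|_{L^p(\mathbb R^n)}.$$ -/

import Mathlib

open MeasureTheory
open scoped ENNReal NNReal Convolution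

/-- The weak Lebesgue (quasi-)norm `‖h‖_{L_{q,∞}} = sup_{t > 0} t · μ{|h| > t}^{1/q}`,
for a finite exponent `q > 0`. -/
noncomputable def weakLpNorm {X : Type*} [MeasurableSpace X] (h : X → ℂ) (q : ℝ)
    (μ : Measure X) : ℝ≥0∞ :=
  ⨆ t : ℝ≥0, (t : ℝ≥0∞) * (μ {x | (t : ℝ≥0∞) < ‖h x‖ₑ}) ^ (1 / q)

/-- Membership in the weak Lebesgue class `L_{q,∞}`. -/
def MemWeakLp {X : Type*} [MeasurableSpace X] (h : X → ℂ) (q : ℝ) (μ : Measure X) : Prop :=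
  AEStronglyMeasurable h μ ∧ weakLpNorm h q μ < ∞

/-- Convolution `(u * v)(x) = ∫ u(y) v(x - y) dy` of complex functions on `ℝⁿ`. -/
noncomputable def convRn {n : ℕ} (u v : EuclideanSpace ℝ (Fin n) → ℂ) :
    EuclideanSpace ℝ (Fin n) → ℂ :=
  u ⋆[ContinuousLinearMap.mul ℂ ℂ, volume] v

/-- For almost every `x` the integral that defines `(u * v)(x)` converges absolutely. -/
def ConvExistsAE {n : ℕ} (u v : EuclideanSpace ℝ (Fin n) → ℂ) : Prop :=
  ∀ᵐ x ∂(volume : Measure (EuclideanSpace ℝ (Fin n))),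
    ConvolutionExistsAt u v x (ContinuousLinearMap.mul ℂ ℂ) volume

/-!
Both operators are dominated by positive ones, built from multiplications by `|g|` and convolutions
with `|g|`, so everything is done for lower Lebesgue integrals of nonnegative functions.

Nonnegative functions `H` are measured by the constants `K` in `∫_A H ≤ K |A|^θ`
(`SetIntegralBound`), where `θ = 1 - 1/r` corresponds to the weak space `L_{r,∞}`. Hölder's
inequality puts `L^p` into this class with `θ = 1/p'` (`SetIntegralBound.of_lintegral_rpow`). By the
layer cake formula in `g`, multiplication by `g ∈ L_{r,∞}` turns `θ` into `θ - 1/r` provided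
`1/r < θ` (`SetIntegralBound.mul`), and convolution turns it into `1 + θ - 1/r` provided
`0 < θ < 1/r` (`SetIntegralBound.conv`). The hypotheses on the exponents make these
conditions hold along the chain, which ends at `θ = 1 - 1/q`; so the operator maps `L^p` to
weak `L^q` (`SetIntegralBound.meas_lt_le`). A set-integral bound also makes the positive
convolutions finite almost everywhere, which is the asserted absolute convergence.

All conditions are strict, so the same weak-type bounds hold at `(1/p ± δ, 1/q ± δ)` for a small
`δ > 0`. As `p ≤ q`, the off-diagonal Marcinkiewicz theorem
(`exists_lintegral_rpow_le_of_weakTypeBound`) upgrades them to the strong bound. It truncates `f` at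
the height `t^(q/p)` when estimating `{T f > 2t}`; for `∫ f^p ≤ 1` the condition `p_i ≤ q_i` allows
all but one power of the truncated integral to be bounded by a power of `t`, and the rest is
Tonelli's theorem.
-/

/-! ### Power integrals on the half-line -/

lemma lintegral_Ioc_rpow {a c : ℝ} (ha : -1 < a) (hc : 0 < c) :
    ∫⁻ t in Set.Ioc 0 c, ENNReal.ofReal (t ^ a) = ENNReal.ofReal (c ^ (a + 1) / (a + 1)) := by
  have hint : IntegrableOn (fun t : ℝ => t ^ a) (Set.Ioc 0 c) :=
    (intervalIntegrable_iff_integrableOn_Ioc_of_le hc.le).1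
      (intervalIntegral.intervalIntegrable_rpow' ha)
  rw [← ofReal_integral_eq_lintegral_ofReal hint, ← intervalIntegral.integral_of_le hc.le,
    integral_rpow (Or.inl ha), Real.zero_rpow (by linarith), sub_zero]
  exact (ae_restrict_iff' measurableSet_Ioc).2 (ae_of_all _ fun t ht => Real.rpow_nonneg ht.1.le _)

lemma lintegral_Ioi_rpow {a c : ℝ} (ha : a < -1) (hc : 0 < c) :
    ∫⁻ t in Set.Ioi c, ENNReal.ofReal (t ^ a) = ENNReal.ofReal (c ^ (a + 1) / (-(a + 1))) := by
  rw [← ofReal_integral_eq_lintegral_ofReal (integrableOn_Ioi_rpow_of_lt ha hc),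
    integral_Ioi_rpow_of_lt ha hc, div_neg, neg_div]
  exact (ae_restrict_iff' measurableSet_Ioi).2
    (ae_of_all _ fun t ht => Real.rpow_nonneg (hc.trans ht).le _)

/-- A function on the half-line dominated by two powers, one integrable at `0` and the other at
`∞`, is integrable, with the bound obtained by switching from one to the other at `c`. -/
lemma lintegral_Ioi_le_of_le_rpow {φ : ℝ → ℝ≥0∞} {a b A B c : ℝ} (ha : a < 1) (hb : 1 < b)
    (hA : 0 ≤ A) (hB : 0 ≤ B) (hc : 0 < c)
    (h₁ : ∀ s, 0 < s → φ s ≤ ENNReal.ofReal (A * s ^ (-a)))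
    (h₂ : ∀ s, 0 < s → φ s ≤ ENNReal.ofReal (B * s ^ (-b))) :
    ∫⁻ s in Set.Ioi 0, φ s ≤
      ENNReal.ofReal (A * (c ^ (1 - a) / (1 - a)) + B * (c ^ (1 - b) / (b - 1))) := by
  have hd : Disjoint (Set.Ioc (0 : ℝ) c) (Set.Ioi c) := Set.Ioc_disjoint_Ioi le_rfl
  rw [← Set.Ioc_union_Ioi_eq_Ioi hc.le, lintegral_union measurableSet_Ioi hd,
    ENNReal.ofReal_add (by have : 0 < 1 - a := by linarith
                           positivity)
      (by have : 0 < b - 1 := by linarith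
          positivity)]
  refine add_le_add ?_ ?_
  · calc ∫⁻ s in Set.Ioc 0 c, φ s
        ≤ ∫⁻ s in Set.Ioc 0 c, ENNReal.ofReal A * ENNReal.ofReal (s ^ (-a)) := by
          refine setLIntegral_mono' measurableSet_Ioc fun s hs => ?_
          rw [← ENNReal.ofReal_mul hA]
          exact h₁ s hs.1
      _ = _ := by
          rw [lintegral_const_mul' _ _ ENNReal.ofReal_ne_top,
            lintegral_Ioc_rpow (by linarith) hc, ← ENNReal.ofReal_mul hA]
          ring_nf
  · calc ∫⁻ s in Set.Ioi c, φ s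
        ≤ ∫⁻ s in Set.Ioi c, ENNReal.ofReal B * ENNReal.ofReal (s ^ (-b)) := by
          refine setLIntegral_mono' measurableSet_Ioi fun s hs => ?_
          rw [← ENNReal.ofReal_mul hB]
          exact h₂ s (hc.trans hs)
      _ = _ := by
          rw [lintegral_const_mul' _ _ ENNReal.ofReal_ne_top,
            lintegral_Ioi_rpow (by linarith) hc, ← ENNReal.ofReal_mul hB]
          ring_nf

lemma rpow_le_mul_lintegral_Ioi_indicator {e : ℝ} (he : 0 < e) (a : ℝ≥0∞) :
    a ^ e ≤ ENNReal.ofReal e *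
      ∫⁻ t in Set.Ioi (0 : ℝ), {t : ℝ | ENNReal.ofReal t < a}.indicator
        (fun t => ENNReal.ofReal (t ^ (e - 1))) t := by
  refine ENNReal.le_of_forall_nnreal_lt fun r hr => ?_
  rcases eq_or_ne r 0 with rfl | hr0
  · simp
  have hc : 0 < (r : ℝ) ^ (1 / e) := Real.rpow_pos_of_pos (by positivity) _
  have hca : ENNReal.ofReal ((r : ℝ) ^ (1 / e)) < a := by
    rw [← ENNReal.ofReal_rpow_of_nonneg r.coe_nonneg (by positivity), ENNReal.ofReal_coe_nnreal,
      one_div, ENNReal.rpow_inv_lt_iff he]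
    exact hr
  calc (r : ℝ≥0∞) = ENNReal.ofReal e *
        ∫⁻ t in Set.Ioc 0 ((r : ℝ) ^ (1 / e)), ENNReal.ofReal (t ^ (e - 1)) := by
        rw [lintegral_Ioc_rpow (by linarith) hc, ← ENNReal.ofReal_mul he.le, sub_add_cancel,
          ← Real.rpow_mul r.coe_nonneg, one_div_mul_cancel he.ne', Real.rpow_one,
          mul_div_cancel₀ _ he.ne', ENNReal.ofReal_coe_nnreal]
    _ ≤ _ := by
        refine mul_le_mul' le_rfl ?_
        calc _ ≤ ∫⁻ t in Set.Ioc 0 ((r : ℝ) ^ (1 / e)),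
                {t : ℝ | ENNReal.ofReal t < a}.indicator
                  (fun t => ENNReal.ofReal (t ^ (e - 1))) t := by
              refine setLIntegral_mono' measurableSet_Ioc fun t ht => ?_
              rw [Set.indicator_of_mem]
              exact (ENNReal.ofReal_le_ofReal ht.2).trans_lt hca
          _ ≤ _ := lintegral_mono_set Set.Ioc_subset_Ioi_self

/-- Layer cake bound for an extended nonnegative function, which may take the value `∞`. -/
lemma lintegral_rpow_le_lintegral_meas_lt {Y : Type*} [MeasurableSpace Y] {ν : Measure Y}
    [SFinite ν] {F : Y → ℝ≥0∞} (hF : Measurable F) {q : ℝ} (hq : 0 < q) :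
    ∫⁻ y, F y ^ q ∂ν ≤ ENNReal.ofReal q *
      ∫⁻ t in Set.Ioi (0 : ℝ), ENNReal.ofReal (t ^ (q - 1)) * ν {y | ENNReal.ofReal t < F y} := by
  have hset : MeasurableSet {z : Y × ℝ | ENNReal.ofReal z.2 < F z.1} :=
    measurableSet_lt (ENNReal.measurable_ofReal.comp measurable_snd) (hF.comp measurable_fst)
  have hm : Measurable (fun z : Y × ℝ => {t : ℝ | ENNReal.ofReal t < F z.1}.indicator
        (fun t => ENNReal.ofReal (t ^ (q - 1))) z.2) := by
    have : Measurable (fun z : Y × ℝ => ENNReal.ofReal (z.2 ^ (q - 1))) := by fun_prop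
    exact this.indicator hset
  calc ∫⁻ y, F y ^ q ∂ν ≤ ∫⁻ y, (ENNReal.ofReal q *
      ∫⁻ t in Set.Ioi (0 : ℝ), {t : ℝ | ENNReal.ofReal t < F y}.indicator
        (fun t => ENNReal.ofReal (t ^ (q - 1))) t) ∂ν :=
        lintegral_mono fun y => rpow_le_mul_lintegral_Ioi_indicator hq _
    _ = _ := by
        rw [lintegral_const_mul' _ _ ENNReal.ofReal_ne_top,
          lintegral_lintegral_swap hm.aemeasurable]
        congr 1
        refine lintegral_congr fun t => ?_
        have hs : MeasurableSet {y | ENNReal.ofReal t < F y} := measurableSet_lt measurable_const hF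
        rw [← lintegral_indicator_const hs]
        rfl

/-! ### Integral bounds over sets of finite measure -/

section SetIntegralBound

variable {X : Type*} [MeasurableSpace X] {μ : Measure X}

/-- `∫_A H ≤ K μ(A)^θ` for every measurable `A` of finite measure. With `θ = 1 - 1/r` and `r > 1`
this is the duality description of the weak space `L_{r,∞}`: unlike the distributional
quasi-norm it is linear in `H`, and only integrals of `H` over sets enter. -/
def SetIntegralBound (H : X → ℝ≥0∞) (θ : ℝ) (K : ℝ≥0∞) (μ : Measure X) : Prop :=
  ∀ A, MeasurableSet A → μ A ≠ ∞ → ∫⁻ x in A, H x ∂μ ≤ K * μ A ^ θ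

lemma SetIntegralBound.ae_lt_top [SigmaFinite μ] {H : X → ℝ≥0∞} {θ : ℝ} {K : ℝ≥0∞}
    (h : SetIntegralBound H θ K μ) (hH : Measurable H) (hθ : 0 ≤ θ) (hK : K ≠ ∞) :
    ∀ᵐ x ∂μ, H x < ∞ := by
  refine ae_of_forall_measure_lt_top_ae_restrict _ fun A hA hμ => ?_
  refine MeasureTheory.ae_lt_top hH (ne_top_of_le_ne_top ?_ (h A hA hμ.ne))
  exact ENNReal.mul_ne_top hK (ENNReal.rpow_ne_top_of_nonneg hθ hμ.ne)

lemma SetIntegralBound.of_lintegral_rpow {f : X → ℝ≥0∞} (hf : Measurable f) {p p' : ℝ}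
    (h : p.HolderConjugate p') :
    SetIntegralBound f (1 / p') ((∫⁻ x, f x ^ p ∂μ) ^ (1 / p)) μ := by
  intro A hA _
  have := ENNReal.lintegral_mul_le_Lp_mul_Lq (μ.restrict A) h hf.aemeasurable
    (g := fun _ => 1) aemeasurable_const
  simp only [Pi.mul_apply, mul_one, ENNReal.one_rpow, lintegral_const,
    Measure.restrict_apply_univ, one_mul] at this
  refine this.trans ?_
  have hp := h.pos
  gcongr
  exact Measure.restrict_le_self

/-- Chebyshev's inequality for a set-integral bound: it implies a bound on the distribution. -/
lemma SetIntegralBound.meas_lt_le [SigmaFinite μ] {H : X → ℝ≥0∞} {q : ℝ} {K : ℝ≥0∞}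
    (h : SetIntegralBound H (1 - 1 / q) K μ) (hH : Measurable H) (hq : 1 < q) {t : ℝ}
    (ht : 0 < t) : μ {x | ENNReal.ofReal t < H x} ≤ (K / ENNReal.ofReal t) ^ q := by
  have hq0 : 0 < q := by linarith
  have hE : MeasurableSet {x | ENNReal.ofReal t < H x} := measurableSet_lt measurable_const hH
  refine le_of_forall_lt fun r hr => ?_
  obtain ⟨A, hA, hAE, hrA, hAt⟩ := Measure.exists_subset_measure_lt_top hE hr
  refine hrA.trans_le ?_
  have hA0 : μ A ≠ 0 := (bot_le.trans_lt hrA).ne'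
  have h1 : ENNReal.ofReal t * μ A ≤ K * μ A ^ (1 - 1 / q) := by
    calc ENNReal.ofReal t * μ A = ∫⁻ x in A, ENNReal.ofReal t ∂μ := by simp
      _ ≤ ∫⁻ x in A, H x ∂μ := setLIntegral_mono' hA fun x hx => (hAE hx).le
      _ ≤ _ := h A hA hAt.ne
  have h2 : ENNReal.ofReal t * μ A ^ (1 / q) ≤ K := by
    have hne : μ A ^ (1 - 1 / q) ≠ 0 := (ENNReal.rpow_pos hA0.bot_lt hAt.ne).ne'
    have hnt : μ A ^ (1 - 1 / q) ≠ ∞ := ENNReal.rpow_ne_top_of_ne_zero hA0 hAt.ne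
    rw [← ENNReal.mul_le_mul_iff_left hne hnt, mul_assoc, ← ENNReal.rpow_add _ _ hA0 hAt.ne]
    simpa using h1
  have ht0 : ENNReal.ofReal t ≠ 0 := by simpa using ht
  have h3 : μ A ^ (1 / q) ≤ K / ENNReal.ofReal t := by
    rw [ENNReal.le_div_iff_mul_le (Or.inl ht0) (Or.inl ENNReal.ofReal_ne_top), mul_comm]
    exact h2
  rwa [one_div, ENNReal.rpow_inv_le_iff hq0] at h3

lemma meas_lt_le_weakLpNorm (g : X → ℂ) {r : ℝ} (hr : 0 < r) {t : ℝ} (ht : 0 < t) :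
    μ {x | t < ‖g x‖} ≤ (weakLpNorm g r μ / ENNReal.ofReal t) ^ r := by
  have ht0 : ENNReal.ofReal t ≠ 0 := by simpa using ht
  have h := le_iSup (fun t : ℝ≥0 => (t : ℝ≥0∞) * (μ {x | (t : ℝ≥0∞) < ‖g x‖ₑ}) ^ (1 / r))
    t.toNNReal
  have hs : {x | t < ‖g x‖} = {x | (t.toNNReal : ℝ≥0∞) < ‖g x‖ₑ} := by
    ext x
    simp only [Set.mem_ofPred_eq, ← ofReal_norm]
    exact (ENNReal.ofReal_lt_ofReal_iff_of_nonneg ht.le).symm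
  rw [← ENNReal.rpow_inv_le_iff hr, ENNReal.le_div_iff_mul_le (Or.inl ht0)
    (Or.inl ENNReal.ofReal_ne_top), mul_comm, hs, ← one_div]
  exact h

/-! ### Weak-type Hölder and Young inequalities -/

lemma ENNReal.exists_ofReal_eq {a : ℝ≥0∞} (h0 : a ≠ 0) (h : a ≠ ∞) :
    ∃ b : ℝ, 0 < b ∧ a = ENNReal.ofReal b :=
  ⟨a.toReal, ENNReal.toReal_pos h0 h, (ENNReal.ofReal_toReal h).symm⟩

/-- The integral met when multiplying by a function of weak type: `x s` stands for the measure of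
its superlevel set at height `s`. -/
lemma lintegral_min_rpow_le {x : ℝ → ℝ≥0∞} {N m : ℝ≥0∞} {r θ : ℝ} (hr : 0 < r)
    (hθ : 1 / r < θ) (hN : N ≠ ∞) (hm : m ≠ ∞)
    (hx : ∀ s, 0 < s → x s ≤ (N / ENNReal.ofReal s) ^ r) :
    ∫⁻ s in Set.Ioi (0 : ℝ), (min m (x s)) ^ θ ≤
      ENNReal.ofReal (1 + 1 / (r * θ - 1)) * N * m ^ (θ - 1 / r) := by
  have hθ0 : 0 < θ := lt_trans (by positivity) hθ
  have hrθ : 1 < r * θ := by rwa [div_lt_iff₀' hr] at hθ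
  rcases eq_or_ne N 0 with rfl | hN0
  · rw [setLIntegral_congr_fun (g := fun _ => 0) measurableSet_Ioi]
    · simp
    · intro s hs
      have : x s = 0 := by simpa [hr] using hx s hs
      simp [this, hθ0]
  rcases eq_or_ne m 0 with rfl | hm0
  · simp [ENNReal.zero_rpow_of_pos hθ0]
  obtain ⟨N, hNpos, rfl⟩ := ENNReal.exists_ofReal_eq hN0 hN
  obtain ⟨m, hmpos, rfl⟩ := ENNReal.exists_ofReal_eq hm0 hm
  -- the two power bounds cross at `s = N m^(-1/r)`
  refine (lintegral_Ioi_le_of_le_rpow (a := 0) (b := r * θ) (A := m ^ θ) (B := N ^ (r * θ))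
    (c := N * m ^ (-(1 / r))) one_pos hrθ (by positivity) (by positivity) (by positivity)
    (fun s hs => ?_) (fun s hs => ?_)).trans_eq ?_
  · rw [neg_zero, Real.rpow_zero, mul_one, ← ENNReal.ofReal_rpow_of_pos hmpos]
    gcongr
    exact min_le_left _ _
  · calc (min (ENNReal.ofReal m) (x s)) ^ θ
        ≤ ((ENNReal.ofReal N / ENNReal.ofReal s) ^ r) ^ θ := by
          gcongr
          exact (min_le_right _ _).trans (hx s hs)
      _ = _ := by
          rw [← ENNReal.rpow_mul, ← ENNReal.ofReal_div_of_pos hs,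
            ENNReal.ofReal_rpow_of_pos (by positivity), Real.div_rpow hNpos.le hs.le,
            Real.rpow_neg hs.le, div_eq_mul_inv]
  · rw [ENNReal.ofReal_rpow_of_pos hmpos, ← ENNReal.ofReal_mul (by
        have : 0 < r * θ - 1 := by linarith
        positivity), ← ENNReal.ofReal_mul (by
        have : 0 < r * θ - 1 := by linarith
        positivity)]
    congr 1
    have e1 : m ^ θ * (N * m ^ (-(1 / r))) = N * m ^ (θ - 1 / r) := by
      rw [sub_eq_add_neg, Real.rpow_add hmpos]; ring
    have e2 : N ^ (r * θ) * (N * m ^ (-(1 / r))) ^ (1 - r * θ) = N * m ^ (θ - 1 / r) := by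
      rw [Real.mul_rpow hNpos.le (by positivity), ← mul_assoc, ← Real.rpow_add hNpos,
        ← Real.rpow_mul hmpos.le]
      congr 2
      · rw [show r * θ + (1 - r * θ) = 1 by ring, Real.rpow_one]
      · field_simp; ring
    rw [sub_zero, Real.rpow_one, div_one, e1, mul_div_assoc', e2]
    ring

/-- The integral met when convolving with a function of weak type: `x s` stands for the measure of
its superlevel set at height `s`. -/
lemma lintegral_min_mul_rpow_le {x : ℝ → ℝ≥0∞} {N m : ℝ≥0∞} {r θ : ℝ} (hr : 1 < r)
    (hθ0 : 0 < θ) (hθ : θ < 1 / r) (hN : N ≠ ∞) (hm : m ≠ ∞)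
    (hx : ∀ s, 0 < s → x s ≤ (N / ENNReal.ofReal s) ^ r) :
    ∫⁻ s in Set.Ioi (0 : ℝ), min (m ^ θ * x s) (m * x s ^ θ) ≤
      ENNReal.ofReal (1 / (1 - r * θ) + 1 / (r - 1)) * N * m ^ (1 + θ - 1 / r) := by
  have hr0 : 0 < r := by linarith
  have hrθ : r * θ < 1 := by rwa [lt_div_iff₀' hr0] at hθ
  have hc : 0 < 1 / (1 - r * θ) + 1 / (r - 1) := by
    have : 0 < r - 1 := by linarith
    have : 0 < 1 - r * θ := by linarith
    positivity
  rcases eq_or_ne N 0 with rfl | hN0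
  · rw [setLIntegral_congr_fun (g := fun _ => 0) measurableSet_Ioi]
    · simp
    · intro s hs
      have : x s = 0 := by simpa [hr0] using hx s hs
      simp [this]
  rcases eq_or_ne m 0 with rfl | hm0
  · simp
  obtain ⟨N, hNpos, rfl⟩ := ENNReal.exists_ofReal_eq hN0 hN
  obtain ⟨m, hmpos, rfl⟩ := ENNReal.exists_ofReal_eq hm0 hm
  have hx' : ∀ s, 0 < s → x s ≤ ENNReal.ofReal (N ^ r * s ^ (-r)) := fun s hs => by
    refine (hx s hs).trans_eq ?_
    rw [← ENNReal.ofReal_div_of_pos hs, ENNReal.ofReal_rpow_of_pos (by positivity),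
      Real.div_rpow hNpos.le hs.le, Real.rpow_neg hs.le, div_eq_mul_inv]
  -- the two power bounds cross at `s = N m^(-1/r)`
  refine (lintegral_Ioi_le_of_le_rpow (a := r * θ) (b := r) (A := m * N ^ (r * θ))
    (B := m ^ θ * N ^ r)
    (c := N * m ^ (-(1 / r))) hrθ hr (by positivity) (by positivity) (by positivity)
    (fun s hs => ?_) (fun s hs => ?_)).trans_eq ?_
  · refine (min_le_right _ _).trans ?_
    rw [mul_assoc, ENNReal.ofReal_mul hmpos.le]
    gcongr
    refine (ENNReal.rpow_le_rpow (hx' s hs) hθ0.le).trans_eq ?_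
    rw [ENNReal.ofReal_rpow_of_pos (by positivity), Real.mul_rpow (by positivity) (by positivity),
      ← Real.rpow_mul hNpos.le, ← Real.rpow_mul hs.le, neg_mul]
  · refine (min_le_left _ _).trans ?_
    rw [mul_assoc, ENNReal.ofReal_mul (by positivity), ENNReal.ofReal_rpow_of_pos hmpos]
    gcongr
    exact hx' s hs
  · rw [ENNReal.ofReal_rpow_of_pos hmpos, ← ENNReal.ofReal_mul hc.le,
      ← ENNReal.ofReal_mul (by positivity)]
    congr 1
    have e1 : m * N ^ (r * θ) * (N * m ^ (-(1 / r))) ^ (1 - r * θ) =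
        N * m ^ (1 + θ - 1 / r) := by
      rw [Real.mul_rpow hNpos.le (by positivity), ← Real.rpow_mul hmpos.le,
        show 1 + θ - 1 / r = 1 + -(1 / r) * (1 - r * θ) by field_simp; ring,
        Real.rpow_add hmpos, Real.rpow_one]
      have : N ^ (r * θ) * N ^ (1 - r * θ) = N := by
        rw [← Real.rpow_add hNpos, show r * θ + (1 - r * θ) = 1 by ring, Real.rpow_one]
      linear_combination (m * m ^ (-(1 / r) * (1 - r * θ))) * this
    have e2 : m ^ θ * N ^ r * (N * m ^ (-(1 / r))) ^ (1 - r) = N * m ^ (1 + θ - 1 / r) := by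
      rw [Real.mul_rpow hNpos.le (by positivity), ← Real.rpow_mul hmpos.le,
        show 1 + θ - 1 / r = θ + -(1 / r) * (1 - r) by field_simp; ring,
        Real.rpow_add hmpos]
      have : N ^ r * N ^ (1 - r) = N := by
        rw [← Real.rpow_add hNpos, show r + (1 - r) = 1 by ring, Real.rpow_one]
      linear_combination (m ^ θ * m ^ (-(1 / r) * (1 - r))) * this
    rw [mul_div_assoc', e1, mul_div_assoc', e2]
    ring

/-- Layer cake formula for the integral of `‖g‖` against a density. -/
lemma lintegral_enorm_mul_eq {ρ : Measure X} {g : X → ℂ} (hg : Measurable g) {H : X → ℝ≥0∞}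
    (hH : Measurable H) :
    ∫⁻ y, ‖g y‖ₑ * H y ∂ρ = ∫⁻ s in Set.Ioi (0 : ℝ), ∫⁻ y in {y | s < ‖g y‖}, H y ∂ρ := by
  have h := lintegral_eq_lintegral_meas_lt (ρ.withDensity H) (f := fun y => ‖g y‖)
    (ae_of_all _ fun _ => norm_nonneg _) hg.norm.aemeasurable
  simp only [ofReal_norm] at h
  rw [lintegral_withDensity_eq_lintegral_mul _ hH hg.enorm] at h
  simp only [Pi.mul_apply] at h
  simp only [mul_comm ‖_‖ₑ, h]
  refine lintegral_congr fun s => ?_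
  rw [withDensity_apply _ (measurableSet_lt measurable_const hg.norm)]

/-- Weak-type Hölder inequality. -/
lemma SetIntegralBound.mul {H : X → ℝ≥0∞} {θ r : ℝ} {K : ℝ≥0∞}
    (h : SetIntegralBound H θ K μ) (hH : Measurable H) {g : X → ℂ} (hg : Measurable g)
    (hr : 0 < r) (hθ : 1 / r < θ) (hN : weakLpNorm g r μ ≠ ∞) :
    SetIntegralBound (fun x => ‖g x‖ₑ * H x) (θ - 1 / r)
      (ENNReal.ofReal (1 + 1 / (r * θ - 1)) * weakLpNorm g r μ * K) μ := by
  intro A hA hAt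
  have hθ0 : 0 < θ := lt_trans (by positivity) hθ
  rw [lintegral_enorm_mul_eq hg hH]
  calc ∫⁻ s in Set.Ioi (0 : ℝ), ∫⁻ y in {y | s < ‖g y‖}, H y ∂(μ.restrict A)
      ≤ ∫⁻ s in Set.Ioi (0 : ℝ), K * (min (μ A) (μ {y | s < ‖g y‖})) ^ θ := by
        refine lintegral_mono fun s => ?_
        have hs : MeasurableSet {y | s < ‖g y‖} := measurableSet_lt measurable_const hg.norm
        rw [Measure.restrict_restrict hs]
        refine (h _ (hs.inter hA) (measure_ne_top_of_subset Set.inter_subset_right hAt)).trans ?_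
        gcongr
        exact le_min (measure_mono Set.inter_subset_right) (measure_mono Set.inter_subset_left)
    _ = K * ∫⁻ s in Set.Ioi (0 : ℝ), (min (μ A) (μ {y | s < ‖g y‖})) ^ θ := by
        have hm : Measurable fun s : ℝ => μ {y | s < ‖g y‖} :=
          Antitone.measurable fun a b hab => measure_mono fun y hy => lt_of_le_of_lt hab hy
        exact lintegral_const_mul _ ((measurable_const.min hm).pow_const _)
    _ ≤ K * (ENNReal.ofReal (1 + 1 / (r * θ - 1)) * weakLpNorm g r μ * μ A ^ (θ - 1 / r)) := by
        gcongr
        exact lintegral_min_rpow_le hr hθ hN hAt fun s hs => meas_lt_le_weakLpNorm g hr hs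
    _ = _ := by ring

end SetIntegralBound

section Group

variable {G : Type*} [AddCommGroup G] [MeasurableSpace G] [MeasurableAdd₂ G] [MeasurableNeg G]
  {μ : Measure G} [SFinite μ]

/-- The convolution of `‖g‖` with a nonnegative function. -/
noncomputable def enormConv (μ : Measure G) (g : G → ℂ) (H : G → ℝ≥0∞) (x : G) : ℝ≥0∞ :=
  ∫⁻ t, ‖g t‖ₑ * H (x - t) ∂μ

lemma measurable_enormConv {g : G → ℂ} (hg : Measurable g) {H : G → ℝ≥0∞}
    (hH : Measurable H) : Measurable (enormConv μ g H) := by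
  unfold enormConv
  apply Measurable.lintegral_prod_right'
    (f := fun z : G × G => ‖g z.2‖ₑ * H (z.1 - z.2))
  exact (hg.comp measurable_snd).enorm.mul (hH.comp measurable_sub)

/-- Weak-type Young inequality. Testing on a set `E`, the superlevel set `B` of `g` at height `s`
contributes `∫_B ∫_E H (x - t) dx dt`, and either of the two integrals may be taken first. -/
lemma SetIntegralBound.conv [μ.IsAddLeftInvariant] [μ.IsNegInvariant] {H : G → ℝ≥0∞} {θ r : ℝ} {K : ℝ≥0∞}
    (h : SetIntegralBound H θ K μ) (hH : Measurable H) {g : G → ℂ} (hg : Measurable g)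
    (hr : 1 < r) (hθ0 : 0 < θ) (hθ : θ < 1 / r) (hN : weakLpNorm g r μ ≠ ∞) :
    SetIntegralBound (enormConv μ g H) (1 + θ - 1 / r)
      (ENNReal.ofReal (1 / (1 - r * θ) + 1 / (r - 1)) * weakLpNorm g r μ * K) μ := by
  intro E hE hEt
  have hr0 : 0 < r := by linarith
  have hsub : Measurable (fun z : G × G => H (z.2 - z.1)) :=
    hH.comp (measurable_snd.sub measurable_fst)
  -- translates and reflected translates of a set carry the same integral bound
  have h1 : ∀ t, ∫⁻ x in E, H (x - t) ∂μ ≤ K * μ E ^ θ := by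
    intro t
    have hmp := measurePreserving_sub_right μ t
    have hE' : MeasurableSet ((fun x => x + t) ⁻¹' E) := measurable_add_const t hE
    have : ∫⁻ x in E, H (x - t) ∂μ = ∫⁻ y in (fun x => x + t) ⁻¹' E, H y ∂μ := by
      rw [← hmp.setLIntegral_comp_preimage hE' hH]
      congr 2
      ext x; simp
    rw [this]
    refine (h _ hE' ?_).trans_eq ?_ <;> rw [measure_preimage_add_right]
    exact hEt
  have h2 : ∀ x, ∀ B, MeasurableSet B → μ B ≠ ∞ → ∫⁻ t in B, H (x - t) ∂μ ≤ K * μ B ^ θ := by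
    intro x B hB hBt
    have hmp := Measure.measurePreserving_sub_left μ x
    have hB' : MeasurableSet ((fun t => x - t) ⁻¹' B) := hmp.measurable hB
    have hμ : μ ((fun t => x - t) ⁻¹' B) = μ B := hmp.measure_preimage hB.nullMeasurableSet
    have : ∫⁻ t in B, H (x - t) ∂μ = ∫⁻ y in (fun t => x - t) ⁻¹' B, H y ∂μ := by
      rw [← hmp.setLIntegral_comp_preimage hB' hH]
      congr 2
      ext t; simp
    rw [this]
    refine (h _ hB' ?_).trans_eq ?_ <;> rw [hμ]
    exact hBt
  have hκ : Measurable fun t => ∫⁻ x in E, H (x - t) ∂μ :=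
    Measurable.lintegral_prod_right' hsub
  calc ∫⁻ x in E, ∫⁻ t, ‖g t‖ₑ * H (x - t) ∂μ ∂μ
      = ∫⁻ t, ‖g t‖ₑ * ∫⁻ x in E, H (x - t) ∂μ ∂μ := by
        rw [lintegral_lintegral_swap]
        · refine lintegral_congr fun t => ?_
          rw [lintegral_const_mul]
          exact hH.comp (measurable_id.sub_const t)
        · exact ((hg.comp measurable_snd).enorm.mul
            (hH.comp measurable_sub)).aemeasurable
    _ = ∫⁻ s in Set.Ioi (0 : ℝ), ∫⁻ t in {t | s < ‖g t‖}, ∫⁻ x in E, H (x - t) ∂μ ∂μ :=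
        lintegral_enorm_mul_eq hg hκ
    _ ≤ ∫⁻ s in Set.Ioi (0 : ℝ),
          K * min (μ E ^ θ * μ {t | s < ‖g t‖}) (μ E * μ {t | s < ‖g t‖} ^ θ) := by
        refine setLIntegral_mono' measurableSet_Ioi fun s hs => ?_
        have hB : MeasurableSet {y | s < ‖g y‖} := measurableSet_lt measurable_const hg.norm
        have hBt : μ {y | s < ‖g y‖} ≠ ∞ := by
          refine ne_top_of_le_ne_top ?_ (meas_lt_le_weakLpNorm g hr0 hs)
          have : ENNReal.ofReal s ≠ 0 := by simpa using hs
          exact ENNReal.rpow_ne_top_of_nonneg hr0.le (ENNReal.div_ne_top hN this)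
        rw [mul_min]
        refine le_min ?_ ?_
        · calc _ ≤ ∫⁻ t in {t | s < ‖g t‖}, K * μ E ^ θ ∂μ := lintegral_mono fun t => h1 t
            _ = _ := by simp [mul_assoc]
        · rw [lintegral_lintegral_swap hsub.aemeasurable]
          calc _ ≤ ∫⁻ x in E, K * μ {t | s < ‖g t‖} ^ θ ∂μ :=
                lintegral_mono fun x => h2 x _ hB hBt
            _ = _ := by simp only [lintegral_const, Measure.restrict_apply_univ]; ring
    _ = K * ∫⁻ s in Set.Ioi (0 : ℝ),
          min (μ E ^ θ * μ {t | s < ‖g t‖}) (μ E * μ {t | s < ‖g t‖} ^ θ) := by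
        have hm : Measurable fun s : ℝ => μ {y | s < ‖g y‖} :=
          Antitone.measurable fun a b hab => measure_mono fun y hy => lt_of_le_of_lt hab hy
        exact lintegral_const_mul _ ((hm.const_mul _).min ((hm.pow_const _).const_mul _))
    _ ≤ K * (ENNReal.ofReal (1 / (1 - r * θ) + 1 / (r - 1)) * weakLpNorm g r μ *
          μ E ^ (1 + θ - 1 / r)) := by
        gcongr
        exact lintegral_min_mul_rpow_le hr hθ0 hθ hN hEt fun s hs => meas_lt_le_weakLpNorm g hr0 hs
    _ = _ := by ring

end Group

/-! ### Real interpolation off the diagonal -/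

section Interpolation

variable {X Y : Type*} [MeasurableSpace X] [MeasurableSpace Y] {μ : Measure X} {ν : Measure Y}

/-- One half of the interpolation argument, for either truncation of `f`: `D` is the region of
pairs `(x, t)` for which `f x` is kept at level `t`. Since `p₀ ≤ q₀`, all but one power of
`∫ (f 1_D)^p₀` can be replaced by its pointwise bound `t^(-e)`, which leaves an expression linear
in `f^p₀` to which Tonelli's theorem applies. -/
lemma lintegral_truncation_le [SFinite μ] {f : X → ℝ≥0∞} (hf : Measurable f)
    {p q p₀ q₀ e : ℝ} (hp₀ : 0 < p₀) (hpq₀ : p₀ ≤ q₀) (he : e * q₀ = p₀ * (q - q₀))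
    (hS : ∫⁻ x, f x ^ p ∂μ ≤ 1) {D : Set (X × ℝ)} (hD : MeasurableSet D)
    (hpt : ∀ x t, 0 < t → (x, t) ∈ D → f x ^ p₀ ≤ ENNReal.ofReal (t ^ (-e)) * f x ^ p)
    {C : ℝ≥0∞}
    (hC : ∀ x, f x ^ p₀ * ∫⁻ t in Set.Ioi (0 : ℝ), {t | (x, t) ∈ D}.indicator
      (fun t => ENNReal.ofReal (t ^ (e - 1))) t ≤ C * f x ^ p) :
    ∫⁻ t in Set.Ioi (0 : ℝ), ENNReal.ofReal (t ^ (q - 1)) *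
      ((∫⁻ x, ({x | (x, t) ∈ D}.indicator f x) ^ p₀ ∂μ) ^ (1 / p₀) / ENNReal.ofReal t) ^ q₀
      ≤ C := by
  have hq₀ : 0 < q₀ := hp₀.trans_le hpq₀
  have hind : ∀ x t, ({x | (x, t) ∈ D}.indicator f x) ^ p₀ =
      {x | (x, t) ∈ D}.indicator (fun x => f x ^ p₀) x := by
    intro x t
    by_cases h : (x, t) ∈ D
    · rw [Set.indicator_of_mem (by exact h), Set.indicator_of_mem (by exact h)]
    · rw [Set.indicator_of_notMem (by exact h), Set.indicator_of_notMem (by exact h),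
        ENNReal.zero_rpow_of_pos hp₀]
  simp only [hind]
  have hmeas : Measurable fun z : ℝ × X => (Prod.swap ⁻¹' D).indicator
      (fun z => ENNReal.ofReal (z.1 ^ (e - 1)) * f z.2 ^ p₀) z := by
    refine Measurable.indicator ?_ (measurable_swap hD)
    have h1 : Measurable fun z : ℝ × X => ENNReal.ofReal (z.1 ^ (e - 1)) := by fun_prop
    exact h1.mul ((hf.comp measurable_snd).pow_const _)
  calc _ ≤ ∫⁻ t in Set.Ioi (0 : ℝ), ∫⁻ x, (Prod.swap ⁻¹' D).indicator
        (fun z => ENNReal.ofReal (z.1 ^ (e - 1)) * f z.2 ^ p₀) (t, x) ∂μ := by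
        refine setLIntegral_mono' measurableSet_Ioi fun t ht => ?_
        have ht : 0 < t := ht
        set I := ∫⁻ x, {x | (x, t) ∈ D}.indicator (fun x => f x ^ p₀) x ∂μ with hI
        have hI1 : I ≤ ENNReal.ofReal (t ^ (-e)) := by
          calc I ≤ ∫⁻ x, ENNReal.ofReal (t ^ (-e)) * f x ^ p ∂μ := by
                refine lintegral_mono fun x => ?_
                by_cases h : (x, t) ∈ D
                · rw [Set.indicator_of_mem (by exact h)]; exact hpt x t ht h
                · rw [Set.indicator_of_notMem (by exact h)]; exact zero_le
            _ ≤ ENNReal.ofReal (t ^ (-e)) * 1 := by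
                rw [lintegral_const_mul' _ _ ENNReal.ofReal_ne_top]
                gcongr
            _ = _ := mul_one _
        have hR : ∫⁻ x, (Prod.swap ⁻¹' D).indicator
            (fun z => ENNReal.ofReal (z.1 ^ (e - 1)) * f z.2 ^ p₀) (t, x) ∂μ =
            ENNReal.ofReal (t ^ (e - 1)) * I := by
          rw [hI, ← lintegral_const_mul' _ _ ENNReal.ofReal_ne_top]
          refine lintegral_congr fun x => ?_
          by_cases h : (x, t) ∈ D
          · rw [Set.indicator_of_mem (by exact h), Set.indicator_of_mem (by exact h)]
          · rw [Set.indicator_of_notMem (by exact h), Set.indicator_of_notMem (by exact h), mul_zero]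
        rw [hR]
        have hpow : (I ^ (1 / p₀) / ENNReal.ofReal t) ^ q₀ ≤
            I * ENNReal.ofReal (t ^ (-e)) ^ (q₀ / p₀ - 1) * ENNReal.ofReal (t ^ (-q₀)) := by
          rw [ENNReal.div_rpow_of_nonneg _ _ hq₀.le, ← ENNReal.rpow_mul, div_eq_mul_inv,
            Real.rpow_neg ht.le q₀, ENNReal.ofReal_inv_of_pos (by positivity),
            ENNReal.ofReal_rpow_of_pos ht]
          gcongr
          have : 0 ≤ q₀ / p₀ - 1 := by rw [sub_nonneg, one_le_div hp₀]; exact hpq₀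
          calc I ^ (1 / p₀ * q₀) = I ^ (1 + (q₀ / p₀ - 1)) := by congr 1; field_simp; ring
            _ = I * I ^ (q₀ / p₀ - 1) := by
                rw [ENNReal.rpow_add_of_nonneg _ _ zero_le_one this, ENNReal.rpow_one]
            _ ≤ _ := by gcongr
        calc _ ≤ ENNReal.ofReal (t ^ (q - 1)) * (I * ENNReal.ofReal (t ^ (-e)) ^ (q₀ / p₀ - 1) *
              ENNReal.ofReal (t ^ (-q₀))) := by gcongr
          _ = (ENNReal.ofReal (t ^ (q - 1)) * ENNReal.ofReal (t ^ (-e)) ^ (q₀ / p₀ - 1) *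
              ENNReal.ofReal (t ^ (-q₀))) * I := by ring
          _ = _ := by
            rw [ENNReal.ofReal_rpow_of_pos (by positivity), ← ENNReal.ofReal_mul (by positivity),
              ← ENNReal.ofReal_mul (by positivity), ← Real.rpow_mul ht.le, ← Real.rpow_add ht,
              ← Real.rpow_add ht]
            congr 3
            field_simp
            linear_combination -he
    _ = ∫⁻ x, (∫⁻ t in Set.Ioi (0 : ℝ), (Prod.swap ⁻¹' D).indicator
        (fun z => ENNReal.ofReal (z.1 ^ (e - 1)) * f z.2 ^ p₀) (t, x)) ∂μ :=
        lintegral_lintegral_swap hmeas.aemeasurable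
    _ ≤ ∫⁻ x, C * f x ^ p ∂μ := by
        refine lintegral_mono fun x => (le_of_eq ?_).trans (hC x)
        rw [← lintegral_const_mul]
        · refine lintegral_congr fun t => ?_
          by_cases h : (x, t) ∈ D
          · rw [Set.indicator_of_mem (by exact h), Set.indicator_of_mem (by exact h), mul_comm]
          · rw [Set.indicator_of_notMem (by exact h), Set.indicator_of_notMem (by exact h), mul_zero]
        · have : Measurable fun t : ℝ => ENNReal.ofReal (t ^ (e - 1)) := by fun_prop
          exact this.indicator (measurable_prodMk_left hD)
    _ ≤ C * 1 := by
        rw [lintegral_const_mul _ (hf.pow_const _)]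
        gcongr
    _ = C := mul_one _

lemma measurable_truncation [SFinite μ] {f : X → ℝ≥0∞} (hf : Measurable f) {p₀ q₀ q : ℝ}
    {D : Set (X × ℝ)} (hD : MeasurableSet D) :
    Measurable fun t : ℝ => ENNReal.ofReal (t ^ (q - 1)) *
      ((∫⁻ x, ({x | (x, t) ∈ D}.indicator f x) ^ p₀ ∂μ) ^ (1 / p₀) / ENNReal.ofReal t) ^ q₀ := by
  have h1 : Measurable fun z : X × ℝ => (D.indicator (fun z => f z.1) z) ^ p₀ :=
    ((hf.comp measurable_fst).indicator hD).pow_const _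
  have h2 : Measurable fun t : ℝ => ∫⁻ x, ({x | (x, t) ∈ D}.indicator f x) ^ p₀ ∂μ :=
    h1.lintegral_prod_left'
  have h3 : Measurable fun t : ℝ => ENNReal.ofReal (t ^ (q - 1)) := by fun_prop
  exact h3.mul (((h2.pow_const _).div ENNReal.measurable_ofReal).pow_const _)

/-- The part of `f` above the level `t^(q/p)`. -/
lemma lintegral_upper_truncation_le [SFinite μ] {f : X → ℝ≥0∞} (hf : Measurable f)
    (hfin : ∀ x, f x ≠ ∞) {p q p₀ q₀ : ℝ} (hp₀ : 0 < p₀) (hp : p₀ < p) (hq : 0 < q)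
    (hpq₀ : p₀ ≤ q₀) (he : q / p * (p - p₀) * q₀ = p₀ * (q - q₀))
    (hS : ∫⁻ x, f x ^ p ∂μ ≤ 1) :
    ∫⁻ t in Set.Ioi (0 : ℝ), ENNReal.ofReal (t ^ (q - 1)) *
      ((∫⁻ x, ({x | (x, t) ∈ {z : X × ℝ | ENNReal.ofReal (z.2 ^ (q / p)) < f z.1}}.indicator f x)
        ^ p₀ ∂μ) ^ (1 / p₀) / ENNReal.ofReal t) ^ q₀
      ≤ ENNReal.ofReal (1 / (q / p * (p - p₀))) := by
  have hp' : 0 < p := hp₀.trans hp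
  have hpp : 0 < p - p₀ := sub_pos.2 hp
  have hD : MeasurableSet {z : X × ℝ | ENNReal.ofReal (z.2 ^ (q / p)) < f z.1} :=
    measurableSet_lt (by fun_prop) (hf.comp measurable_fst)
  refine lintegral_truncation_le hf hp₀ hpq₀ he hS hD ?_ ?_
  · intro x t ht hx
    have hx : ENNReal.ofReal (t ^ (q / p)) < f x := hx
    obtain ⟨a, ha, hfa⟩ := ENNReal.exists_ofReal_eq (ne_bot_of_gt hx) (hfin x)
    rw [hfa] at hx ⊢
    have hx := (ENNReal.ofReal_lt_ofReal_iff ha).1 hx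
    rw [ENNReal.ofReal_rpow_of_pos ha, ENNReal.ofReal_rpow_of_pos ha,
      ← ENNReal.ofReal_mul (by positivity)]
    refine ENNReal.ofReal_le_ofReal ?_
    have e1 : a ^ p₀ = a ^ (-(p - p₀)) * a ^ p := by rw [← Real.rpow_add ha]; ring_nf
    rw [e1, show -(q / p * (p - p₀)) = q / p * (-(p - p₀)) by ring, Real.rpow_mul ht.le]
    refine mul_le_mul_of_nonneg_right ?_ (by positivity)
    exact Real.rpow_le_rpow_of_nonpos (Real.rpow_pos_of_pos ht _) hx.le (neg_nonpos.2 hpp.le)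
  · intro x
    rcases eq_or_ne (f x) 0 with h0 | h0
    · simp [h0, ENNReal.zero_rpow_of_pos hp₀]
    obtain ⟨a, ha, hfa⟩ := ENNReal.exists_ofReal_eq h0 (hfin x)
    have hκ : 0 < q / p := by positivity
    calc _ ≤ f x ^ p₀ * ∫⁻ t in Set.Ioc (0 : ℝ) (a ^ (p / q)),
            ENNReal.ofReal (t ^ (q / p * (p - p₀) - 1)) := by
          refine mul_le_mul' le_rfl ?_
          rw [← lintegral_indicator measurableSet_Ioi, ← lintegral_indicator measurableSet_Ioc]
          refine lintegral_mono fun t => ?_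
          by_cases ht : 0 < t
          · by_cases hx : (x, t) ∈ {z : X × ℝ | ENNReal.ofReal (z.2 ^ (q / p)) < f z.1}
            · rw [Set.indicator_of_mem (by exact ht), Set.indicator_of_mem (by exact hx),
                Set.indicator_of_mem]
              refine ⟨ht, ?_⟩
              have hx : ENNReal.ofReal (t ^ (q / p)) < f x := hx
              rw [hfa, ENNReal.ofReal_lt_ofReal_iff ha] at hx
              rw [show p / q = (q / p)⁻¹ by rw [inv_div],
                Real.le_rpow_inv_iff_of_pos ht.le ha.le hκ]
              exact hx.le
            · rw [Set.indicator_of_mem (by exact ht), Set.indicator_of_notMem (by exact hx)]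
              exact zero_le
          · rw [Set.indicator_of_notMem (by exact ht)]; exact zero_le
      _ = _ := by
          rw [lintegral_Ioc_rpow (by have : 0 < q / p * (p - p₀) := by positivity
                                     linarith) (by positivity), hfa,
            ENNReal.ofReal_rpow_of_pos ha, ENNReal.ofReal_rpow_of_pos ha,
            ← ENNReal.ofReal_mul (by positivity), ← ENNReal.ofReal_mul (by positivity),
            ← Real.rpow_mul ha.le]
          congr 1
          rw [show p / q * (q / p * (p - p₀) - 1 + 1) = p - p₀ by field_simp; ring, sub_add_cancel,
            mul_div_assoc', ← Real.rpow_add ha, add_sub_cancel]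
          ring

/-- The part of `f` below the level `t^(q/p)`. -/
lemma lintegral_lower_truncation_le [SFinite μ] {f : X → ℝ≥0∞} (hf : Measurable f)
    (hfin : ∀ x, f x ≠ ∞) {p q p₁ q₁ : ℝ} (hp : 0 < p) (hp₁ : p < p₁) (hq : 0 < q)
    (hpq₁ : p₁ ≤ q₁) (he : q / p * (p - p₁) * q₁ = p₁ * (q - q₁))
    (hS : ∫⁻ x, f x ^ p ∂μ ≤ 1) :
    ∫⁻ t in Set.Ioi (0 : ℝ), ENNReal.ofReal (t ^ (q - 1)) *
      ((∫⁻ x, ({x | (x, t) ∈ {z : X × ℝ | f z.1 ≤ ENNReal.ofReal (z.2 ^ (q / p))}}.indicator f x)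
        ^ p₁ ∂μ) ^ (1 / p₁) / ENNReal.ofReal t) ^ q₁
      ≤ ENNReal.ofReal (1 / (q / p * (p₁ - p))) := by
  have hp₁' : 0 < p₁ := hp.trans hp₁
  have hpp : 0 < p₁ - p := sub_pos.2 hp₁
  have hD : MeasurableSet {z : X × ℝ | f z.1 ≤ ENNReal.ofReal (z.2 ^ (q / p))} :=
    measurableSet_le (hf.comp measurable_fst) (by fun_prop)
  refine lintegral_truncation_le hf hp₁' hpq₁ he hS hD ?_ ?_
  · intro x t ht hx
    have hx : f x ≤ ENNReal.ofReal (t ^ (q / p)) := hx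
    rcases eq_or_ne (f x) 0 with h0 | h0
    · simp [h0, ENNReal.zero_rpow_of_pos hp₁']
    obtain ⟨a, ha, hfa⟩ := ENNReal.exists_ofReal_eq h0 (hfin x)
    rw [hfa] at hx ⊢
    have hx := (ENNReal.ofReal_le_ofReal_iff (by positivity)).1 hx
    rw [ENNReal.ofReal_rpow_of_pos ha, ENNReal.ofReal_rpow_of_pos ha,
      ← ENNReal.ofReal_mul (by positivity)]
    refine ENNReal.ofReal_le_ofReal ?_
    have e1 : a ^ p₁ = a ^ (p₁ - p) * a ^ p := by rw [← Real.rpow_add ha]; ring_nf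
    rw [e1, show -(q / p * (p - p₁)) = q / p * (p₁ - p) by ring, Real.rpow_mul ht.le]
    gcongr
  · intro x
    rcases eq_or_ne (f x) 0 with h0 | h0
    · simp [h0, ENNReal.zero_rpow_of_pos hp₁']
    obtain ⟨a, ha, hfa⟩ := ENNReal.exists_ofReal_eq h0 (hfin x)
    have hκ : 0 < q / p := by positivity
    have hneg : q / p * (p - p₁) < 0 := mul_neg_of_pos_of_neg hκ (by linarith)
    calc _ ≤ f x ^ p₁ * ∫⁻ t in Set.Ici (a ^ (p / q)),
            ENNReal.ofReal (t ^ (q / p * (p - p₁) - 1)) := by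
          refine mul_le_mul' le_rfl ?_
          rw [← lintegral_indicator measurableSet_Ioi, ← lintegral_indicator measurableSet_Ici]
          refine lintegral_mono fun t => ?_
          by_cases ht : 0 < t
          · by_cases hx : (x, t) ∈ {z : X × ℝ | f z.1 ≤ ENNReal.ofReal (z.2 ^ (q / p))}
            · rw [Set.indicator_of_mem (by exact ht), Set.indicator_of_mem (by exact hx),
                Set.indicator_of_mem]
              have hx : f x ≤ ENNReal.ofReal (t ^ (q / p)) := hx
              rw [hfa, ENNReal.ofReal_le_ofReal_iff (by positivity)] at hx
              rw [Set.mem_Ici, show p / q = (q / p)⁻¹ by rw [inv_div],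
                Real.rpow_inv_le_iff_of_pos ha.le ht.le hκ]
              exact hx
            · rw [Set.indicator_of_mem (by exact ht), Set.indicator_of_notMem (by exact hx)]
              exact zero_le
          · rw [Set.indicator_of_notMem (by exact ht)]; exact zero_le
      _ = _ := by
          rw [setLIntegral_congr Ioi_ae_eq_Ici.symm,
            lintegral_Ioi_rpow (by linarith) (by positivity), hfa,
            ENNReal.ofReal_rpow_of_pos ha, ENNReal.ofReal_rpow_of_pos ha,
            ← ENNReal.ofReal_mul (by positivity), ← ENNReal.ofReal_mul (by positivity),
            ← Real.rpow_mul ha.le]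
          congr 1
          rw [show p / q * (q / p * (p - p₁) - 1 + 1) = p - p₁ by field_simp; ring, sub_add_cancel,
            mul_div_assoc', ← Real.rpow_add ha, add_sub_cancel]
          rw [show -(q / p * (p - p₁)) = q / p * (p₁ - p) by ring]
          ring

/-- A weak-type bound `ν {T f > t} ≤ (A ‖f‖_p / t)^q`. -/
def WeakTypeBound (T : (X → ℝ≥0∞) → Y → ℝ≥0∞) (p q : ℝ) (A : ℝ≥0∞) (μ : Measure X)
    (ν : Measure Y) : Prop :=
  ∀ f, Measurable f → ∀ t : ℝ, 0 < t → ν {y | ENNReal.ofReal t < T f y} ≤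
    (A * (∫⁻ x, f x ^ p ∂μ) ^ (1 / p) / ENNReal.ofReal t) ^ q

/-- The normalised form of the interpolation theorem. -/
lemma lintegral_half_rpow_le_of_weakTypeBound [SFinite μ] [SFinite ν]
    {T : (X → ℝ≥0∞) → Y → ℝ≥0∞} {p q p₀ q₀ p₁ q₁ : ℝ}
    (hp₀ : 0 < p₀) (hp : p₀ < p) (hp₁ : p < p₁) (hq : 0 < q) (hpq₀ : p₀ ≤ q₀) (hpq₁ : p₁ ≤ q₁)
    (he₀ : q / p * (p - p₀) * q₀ = p₀ * (q - q₀)) (he₁ : q / p * (p - p₁) * q₁ = p₁ * (q - q₁))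
    (hTm : ∀ f, Measurable f → Measurable (T f))
    (hTadd : ∀ f g, Measurable f → Measurable g → ∀ y, T (f + g) y ≤ T f y + T g y)
    (h₀ : WeakTypeBound T p₀ q₀ 1 μ ν) (h₁ : WeakTypeBound T p₁ q₁ 1 μ ν)
    {f : X → ℝ≥0∞} (hf : Measurable f) (hfin : ∀ x, f x ≠ ∞) (hS : ∫⁻ x, f x ^ p ∂μ ≤ 1) :
    ∫⁻ y, (T f y / 2) ^ q ∂ν ≤ ENNReal.ofReal q *
      (ENNReal.ofReal (1 / (q / p * (p - p₀))) + ENNReal.ofReal (1 / (q / p * (p₁ - p)))) := by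
  have hD₀ : MeasurableSet {z : X × ℝ | ENNReal.ofReal (z.2 ^ (q / p)) < f z.1} :=
    measurableSet_lt (by fun_prop) (hf.comp measurable_fst)
  have hD₁ : MeasurableSet {z : X × ℝ | f z.1 ≤ ENNReal.ofReal (z.2 ^ (q / p))} :=
    measurableSet_le (hf.comp measurable_fst) (by fun_prop)
  refine (lintegral_rpow_le_lintegral_meas_lt ((hTm f hf).div_const 2) hq).trans ?_
  gcongr
  refine le_trans ?_ (add_le_add
    (lintegral_upper_truncation_le hf hfin hp₀ hp hq hpq₀ he₀ hS)
    (lintegral_lower_truncation_le hf hfin (hp₀.trans hp) hp₁ hq hpq₁ he₁ hS))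
  rw [← lintegral_add_left (measurable_truncation hf hD₀)]
  refine setLIntegral_mono' measurableSet_Ioi fun t ht => ?_
  rw [← mul_add]
  gcongr
  set f₀ := {x | (x, t) ∈ {z : X × ℝ | ENNReal.ofReal (z.2 ^ (q / p)) < f z.1}}.indicator f
    with hf₀
  set f₁ := {x | (x, t) ∈ {z : X × ℝ | f z.1 ≤ ENNReal.ofReal (z.2 ^ (q / p))}}.indicator f
    with hf₁
  have hm₀ : Measurable f₀ := hf.indicator (measurable_prodMk_right hD₀)
  have hm₁ : Measurable f₁ := hf.indicator (measurable_prodMk_right hD₁)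
  have hsum : f = f₀ + f₁ := by
    funext x
    by_cases h : ENNReal.ofReal (t ^ (q / p)) < f x
    · simp [hf₀, hf₁, h, h.not_ge]
    · simp [hf₀, hf₁, h, not_lt.1 h]
  calc ν {y | ENNReal.ofReal t < T f y / 2}
      ≤ ν ({y | ENNReal.ofReal t < T f₀ y} ∪ {y | ENNReal.ofReal t < T f₁ y}) := by
        refine measure_mono fun y hy => ?_
        by_contra hcon
        simp only [Set.mem_union, Set.mem_ofPred_eq, not_or, not_lt] at hcon
        have hy : ENNReal.ofReal t < T f y / 2 := hy
        refine hy.not_ge ?_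
        refine ENNReal.div_le_of_le_mul ?_
        rw [mul_two, hsum]
        exact (hTadd _ _ hm₀ hm₁ y).trans (add_le_add hcon.1 hcon.2)
    _ ≤ _ := measure_union_le _ _
    _ ≤ _ := add_le_add (by simpa using h₀ f₀ hm₀ t ht) (by simpa using h₁ f₁ hm₁ t ht)

/-- Off-diagonal Marcinkiewicz interpolation: two weak-type bounds at exponents `(1/p ± δ, 1/q ± δ)`
on either side of `(1/p, 1/q)` give the strong-type bound there, as long as `p_i ≤ q_i`. -/
theorem exists_lintegral_rpow_le_of_weakTypeBound (μ : Measure X) (ν : Measure Y)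
    [SFinite μ] [SFinite ν] {p q p₀ q₀ p₁ q₁ : ℝ}
    (hp₀ : 0 < p₀) (hp : p₀ < p) (hp₁ : p < p₁) (hq : 0 < q) (hpq₀ : p₀ ≤ q₀) (hpq₁ : p₁ ≤ q₁)
    (he₀ : q / p * (p - p₀) * q₀ = p₀ * (q - q₀))
    (he₁ : q / p * (p - p₁) * q₁ = p₁ * (q - q₁)) :
    ∃ C : ℝ≥0, ∀ (T : (X → ℝ≥0∞) → Y → ℝ≥0∞) (A : ℝ≥0∞), A ≠ ∞ →
      (∀ f, Measurable f → Measurable (T f)) →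
      (∀ f g, Measurable f → Measurable g → ∀ y, T (f + g) y ≤ T f y + T g y) →
      WeakTypeBound T p₀ q₀ A μ ν → WeakTypeBound T p₁ q₁ A μ ν →
      ∀ f : X → ℝ≥0∞, Measurable f → (∀ x, f x ≠ ∞) → ∫⁻ x, f x ^ p ∂μ ≠ ∞ →
        (∫⁻ y, T f y ^ q ∂ν) ^ (1 / q) ≤ C * (A * (∫⁻ x, f x ^ p ∂μ) ^ (1 / p)) := by
  have hp' : 0 < p := hp₀.trans hp
  set C₀ : ℝ≥0∞ := ENNReal.ofReal q *
      (ENNReal.ofReal (1 / (q / p * (p - p₀))) + ENNReal.ofReal (1 / (q / p * (p₁ - p))))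
  have hC₀ : C₀ ≠ ∞ := by finiteness
  set C : ℝ≥0∞ := 2 * C₀ ^ (1 / q) + 1 with hCdef
  have hC : C ≠ ∞ := by
    have := ENNReal.rpow_ne_top_of_nonneg (y := 1 / q) (by positivity) hC₀
    finiteness
  refine ⟨C.toNNReal, fun T A hA hTm hTadd h₀ h₁ f hf hfin hS => ?_⟩
  rw [ENNReal.coe_toNNReal hC]
  have hC0 : C ≠ 0 := by simp [hCdef]
  rw [mul_comm C, ← ENNReal.div_le_iff hC0 hC]
  refine ENNReal.le_mul_of_forall_lt (Or.inr (ENNReal.rpow_ne_top_of_nonneg (by positivity) hS))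
    (Or.inl hA) fun A' hA' S hSS => ?_
  rcases eq_or_ne A' ∞ with rfl | hA't
  · rw [ENNReal.top_mul (ne_bot_of_gt hSS)]; exact le_top
  rcases eq_or_ne S ∞ with rfl | hSt
  · rw [ENNReal.mul_top (ne_bot_of_gt hA')]; exact le_top
  have hA0 : A' ≠ 0 := ne_bot_of_gt hA'
  have hS0 : S ≠ 0 := ne_bot_of_gt hSS
  have hAS0 : A' * S ≠ 0 := mul_ne_zero hA0 hS0
  have hASt : A' * S ≠ ∞ := ENNReal.mul_ne_top hA't hSt
  have hweak : ∀ p q : ℝ, 0 < p → 0 < q → WeakTypeBound T p q A μ ν →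
      WeakTypeBound (fun f y => T (fun x => S * f x) y / (A' * S)) p q 1 μ ν := by
    intro p q hp hq h f hf t ht
    obtain ⟨b, hb, hbeq⟩ := ENNReal.exists_ofReal_eq hAS0 hASt
    have := h (fun x => S * f x) (hf.const_mul S) (t * b) (by positivity)
    rw [ENNReal.ofReal_mul ht.le, ← hbeq] at this
    refine (measure_mono fun y hy => ?_).trans (this.trans ?_)
    · exact (ENNReal.lt_div_iff_mul_lt (Or.inl hAS0) (Or.inl hASt)).1 hy
    · refine ENNReal.rpow_le_rpow ?_ hq.le
      simp only [ENNReal.mul_rpow_of_nonneg _ _ hp.le]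
      rw [lintegral_const_mul' _ _ (ENNReal.rpow_ne_top_of_nonneg hp.le hSt),
        ENNReal.mul_rpow_of_nonneg _ _ (by positivity), ← ENNReal.rpow_mul,
        mul_one_div_cancel hp.ne', ENNReal.rpow_one, one_mul]
      have ht0 : ENNReal.ofReal t ≠ 0 := by simpa using ht
      calc A * (S * (∫⁻ x, f x ^ p ∂μ) ^ (1 / p)) / (ENNReal.ofReal t * (A' * S))
          ≤ (A' * S) * (∫⁻ x, f x ^ p ∂μ) ^ (1 / p) / ((A' * S) * ENNReal.ofReal t) := by
            rw [mul_comm (ENNReal.ofReal t), ← mul_assoc]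
            gcongr
        _ = _ := ENNReal.mul_div_mul_left _ _ hAS0 hASt
  have key := lintegral_half_rpow_le_of_weakTypeBound (μ := μ) (ν := ν)
    (T := fun f y => T (fun x => S * f x) y / (A' * S)) hp₀ hp hp₁ hq hpq₀ hpq₁ he₀ he₁
    (fun f hf => (hTm _ (hf.const_mul S)).div_const _)
    (fun f g hf hg y => by
      rw [← ENNReal.add_div]
      gcongr
      have := hTadd _ _ (hf.const_mul S) (hg.const_mul S) y
      simp only [Pi.add_apply, mul_add]
      exact this)
    (hweak _ _ hp₀ (hp₀.trans_le hpq₀) h₀)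
    (hweak _ _ (hp'.trans hp₁) ((hp'.trans hp₁).trans_le hpq₁) h₁)
    (f := fun x => f x / S) (hf.div_const S) (fun x => ENNReal.div_ne_top (hfin x) hS0)
    (by
      simp only [div_eq_mul_inv, ENNReal.mul_rpow_of_nonneg _ _ hp'.le]
      rw [lintegral_mul_const _ (hf.pow_const _), ENNReal.inv_rpow, ← div_eq_mul_inv]
      refine ENNReal.div_le_of_le_mul ?_
      rw [one_mul, ← ENNReal.rpow_inv_le_iff hp', ← one_div]
      exact hSS.le)
  have hcancel : (fun x => S * (f x / S)) = f := by
    funext x; exact ENNReal.mul_div_cancel hS0 hSt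
  simp only [hcancel] at key
  have key2 : (∫⁻ y, T f y ^ q ∂ν) ^ (1 / q) / (A' * S) / 2 ≤ C₀ ^ (1 / q) := by
    rw [one_div, ENNReal.le_rpow_inv_iff hq]
    refine le_trans (le_of_eq ?_) key
    simp only [ENNReal.div_rpow_of_nonneg _ _ hq.le]
    rw [ENNReal.rpow_inv_rpow hq.ne']
    simp only [div_eq_mul_inv]
    rw [lintegral_mul_const', lintegral_mul_const']
    · exact ENNReal.inv_ne_top.2 (ENNReal.rpow_pos hAS0.bot_lt hASt).ne'
    · exact ENNReal.inv_ne_top.2 (ENNReal.rpow_pos two_pos (by simp)).ne'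
  rw [ENNReal.div_le_iff two_ne_zero (by simp), ENNReal.div_le_iff hAS0 hASt] at key2
  rw [ENNReal.div_le_iff hC0 hC]
  refine key2.trans ?_
  rw [mul_comm (A' * S)]
  gcongr
  rw [hCdef, mul_comm]
  exact le_self_add

lemma SetIntegralBound.mono {H : X → ℝ≥0∞} {θ : ℝ} {K K' : ℝ≥0∞}
    (h : SetIntegralBound H θ K μ) (hK : K ≤ K') : SetIntegralBound H θ K' μ :=
  fun A hA hμ => (h A hA hμ).trans (by gcongr)

/-- An operator that maps set-integral bounds to set-integral bounds is of weak type. -/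
lemma WeakTypeBound.of_setIntegralBound [SigmaFinite ν]
    {T : (X → ℝ≥0∞) → Y → ℝ≥0∞} {p q : ℝ} {A : ℝ≥0∞} (hp : 1 < p) (hq : 1 < q)
    (hTm : ∀ f, Measurable f → Measurable (T f))
    (h : ∀ f, Measurable f → ∀ K, SetIntegralBound f (1 - 1 / p) K μ →
      SetIntegralBound (T f) (1 - 1 / q) (A * K) ν) :
    WeakTypeBound T p q A μ ν := by
  intro f hf t ht
  have hpp := Real.HolderConjugate.conjExponent hp
  have hf' := SetIntegralBound.of_lintegral_rpow (μ := μ) hf hpp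
  rw [one_div p.conjExponent, ← hpp.one_sub_inv, ← one_div] at hf'
  exact (h f hf _ hf').meas_lt_le (hTm f hf) hq ht

/-- Strong-type bound for an operator that maps set-integral bounds to set-integral bounds for the
two perturbed exponents `(1/p ± δ, 1/q ± δ)`. -/
theorem exists_lintegral_rpow_le_of_setIntegralBound (μ : Measure X) (ν : Measure Y)
    [SFinite μ] [SigmaFinite ν] {p q p' δ : ℝ} (hpq : p ≤ q) (hpp' : p.HolderConjugate p')
    (hδ : 0 < δ) (hδp' : δ < 1 / p') (hδq : δ < 1 / q) (hδq' : δ < 1 - 1 / q) :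
    ∃ C : ℝ≥0, ∀ (T : (X → ℝ≥0∞) → Y → ℝ≥0∞) (A : ℝ≥0∞), A ≠ ∞ →
      (∀ f, Measurable f → Measurable (T f)) →
      (∀ f g, Measurable f → Measurable g → ∀ y, T (f + g) y ≤ T f y + T g y) →
      (∀ s, s = δ ∨ s = -δ → ∀ f, Measurable f → ∀ K, SetIntegralBound f (1 / p' - s) K μ →
        SetIntegralBound (T f) (1 - 1 / q - s) (A * K) ν) →
      ∀ f : X → ℝ≥0∞, Measurable f → (∀ x, f x ≠ ∞) → ∫⁻ x, f x ^ p ∂μ ≠ ∞ →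
        (∫⁻ y, T f y ^ q ∂ν) ^ (1 / q) ≤ C * (A * (∫⁻ x, f x ^ p ∂μ) ^ (1 / p)) := by
  have hp : 0 < p := hpp'.pos
  have hq : 0 < q := hp.trans_le hpq
  have hqp : 1 / q ≤ 1 / p := one_div_le_one_div_of_le hp hpq
  have hsum : 1 / p + 1 / p' = 1 := by simpa using hpp'.inv_add_inv_eq_one
  have a0 : 0 < 1 / p := by positivity
  have b0 : 0 < 1 / q := by positivity
  have am : 0 < 1 / p - δ := by linarith
  have bm : 0 < 1 / q - δ := by linarith
  have ap : 0 < 1 / p + δ := by linarith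
  have bp : 0 < 1 / q + δ := by linarith
  have hrel : ∀ s, 0 < 1 / p + s → 0 < 1 / q + s →
      q / p * (p - 1 / (1 / p + s)) * (1 / (1 / q + s)) =
        1 / (1 / p + s) * (q - 1 / (1 / q + s)) := by
    intro s h1 h2
    have e1 : 1 / p + s = (1 + p * s) / p := by field_simp
    have e2 : 1 / q + s = (1 + q * s) / q := by field_simp
    have h1' : 1 + p * s ≠ 0 := by
      intro h; rw [e1, h] at h1; simp at h1
    have h2' : 1 + q * s ≠ 0 := by
      intro h; rw [e2, h] at h2; simp at h2
    rw [e1, e2]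
    field_simp
    ring
  obtain ⟨C, hC⟩ := exists_lintegral_rpow_le_of_weakTypeBound μ ν (p := p) (q := q)
    (p₀ := 1 / (1 / p + δ)) (q₀ := 1 / (1 / q + δ)) (p₁ := 1 / (1 / p - δ))
    (q₁ := 1 / (1 / q - δ)) (by positivity)
    (by rw [one_div_lt ap hp]; linarith) (by rw [lt_one_div hp am]; linarith) hq
    (one_div_le_one_div_of_le bp (by linarith)) (one_div_le_one_div_of_le bm (by linarith))
    (hrel δ ap bp) (by simpa only [sub_eq_add_neg] using hrel (-δ) (by linarith) (by linarith))
  refine ⟨C, fun T A hA hTm hTadd hT => hC T A hA hTm hTadd ?_ ?_⟩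
  · refine WeakTypeBound.of_setIntegralBound ?_ ?_ hTm ?_
    · rw [lt_one_div one_pos ap]; linarith
    · rw [lt_one_div one_pos bp]; linarith
    · intro f hf K hK
      rw [one_div_one_div] at hK ⊢
      have := hT δ (Or.inl rfl) f hf K (by convert hK using 1; linarith)
      convert this using 1; ring
  · refine WeakTypeBound.of_setIntegralBound ?_ ?_ hTm ?_
    · rw [lt_one_div one_pos am]; linarith
    · rw [lt_one_div one_pos bm]; linarith
    · intro f hf K hK
      rw [one_div_one_div] at hK ⊢
      have := hT (-δ) (Or.inr rfl) f hf K (by convert hK using 1; linarith)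
      convert this using 1; ring

end Interpolation

/-! ### Weak-type bounds for the multiplication and convolution operators -/

section Operators

variable {n : ℕ}

local notation "E" n => EuclideanSpace ℝ (Fin n)

lemma enormConv_mono {g : (E n) → ℂ} {H H' : (E n) → ℝ≥0∞} (h : ∀ x, H x ≤ H' x) (x : E n) :
    enormConv volume g H x ≤ enormConv volume g H' x :=
  lintegral_mono fun t => by gcongr; exact h _

lemma enormConv_add {g : (E n) → ℂ} (hg : Measurable g) {H H' : (E n) → ℝ≥0∞} (hH : Measurable H)
    (x : E n) :
    enormConv volume g (fun y => H y + H' y) x =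
      enormConv volume g H x + enormConv volume g H' x := by
  unfold enormConv
  simp only [mul_add]
  exact lintegral_add_left (hg.enorm.mul (hH.comp (measurable_id.const_sub x))) _

/-- The positive operator `f ↦ |g| * (|h| f)`. -/
noncomputable def convMul (g h : (E n) → ℂ) (f : (E n) → ℝ≥0∞) : (E n) → ℝ≥0∞ :=
  enormConv volume g fun y => ‖h y‖ₑ * f y

lemma measurable_convMul {g h : (E n) → ℂ} (hg : Measurable g) (hh : Measurable h)
    {f : (E n) → ℝ≥0∞} (hf : Measurable f) : Measurable (convMul g h f) :=
  measurable_enormConv hg (hh.enorm.mul hf)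

lemma convMul_mono {g h : (E n) → ℂ} {f f' : (E n) → ℝ≥0∞} (hf : ∀ x, f x ≤ f' x) (x : E n) :
    convMul g h f x ≤ convMul g h f' x :=
  enormConv_mono (fun y => by gcongr; exact hf y) x

lemma convMul_add {g h : (E n) → ℂ} (hg : Measurable g) (hh : Measurable h)
    {f f' : (E n) → ℝ≥0∞} (hf : Measurable f) :
    convMul g h (f + f') = convMul g h f + convMul g h f' := by
  funext x
  simp only [convMul, Pi.add_apply, mul_add]
  exact enormConv_add hg (hh.enorm.mul hf) x

lemma exists_setIntegralBound_convMul (n : ℕ) {a b θ : ℝ} (ha : 1 < a) (hb : 0 < b)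
    (h1 : 1 / b < θ) (h2 : θ - 1 / b < 1 / a) :
    ∃ C : ℝ≥0, ∀ (g h : (E n) → ℂ), Measurable g → Measurable h →
      weakLpNorm g a volume ≠ ∞ → weakLpNorm h b volume ≠ ∞ →
      ∀ f, Measurable f → ∀ K, SetIntegralBound f θ K volume →
        SetIntegralBound (convMul g h f) (1 + θ - 1 / b - 1 / a)
          (C * (weakLpNorm g a volume * weakLpNorm h b volume) * K) volume := by
  refine ⟨(1 / (1 - a * (θ - 1 / b)) + 1 / (a - 1)).toNNReal *
    (1 + 1 / (b * θ - 1)).toNNReal, fun g h hg hh hgN hhN f hf K hK => ?_⟩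
  have := (hK.mul hf hh hb h1 hhN).conv (hh.enorm.mul hf) hg ha (by linarith) h2 hgN
  convert this using 1
  · rfl
  · ring
  · rw [ENNReal.coe_mul]
    simp only [ENNReal.ofReal]
    ring

lemma exists_setIntegralBound_mul_convMul (n : ℕ) {r₀ r₁ r₂ θ : ℝ} (h₀ : 0 < r₀) (h₁ : 1 < r₁)
    (h₂ : 0 < r₂) (hθ₂ : 1 / r₂ < θ) (hθ₁ : θ - 1 / r₂ < 1 / r₁)
    (hθ₀ : 1 / r₀ < 1 + θ - 1 / r₂ - 1 / r₁) :
    ∃ C : ℝ≥0, ∀ (g₀ g₁ g₂ : (E n) → ℂ), Measurable g₀ → Measurable g₁ → Measurable g₂ →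
      weakLpNorm g₀ r₀ volume ≠ ∞ → weakLpNorm g₁ r₁ volume ≠ ∞ → weakLpNorm g₂ r₂ volume ≠ ∞ →
      ∀ f, Measurable f → ∀ K, SetIntegralBound f θ K volume →
        SetIntegralBound (fun x => ‖g₀ x‖ₑ * convMul g₁ g₂ f x)
          (1 + θ - 1 / r₂ - 1 / r₁ - 1 / r₀)
          (C * (weakLpNorm g₀ r₀ volume * weakLpNorm g₁ r₁ volume * weakLpNorm g₂ r₂ volume) * K)
          volume := by
  obtain ⟨C, hC⟩ := exists_setIntegralBound_convMul n h₁ h₂ hθ₂ hθ₁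
  refine ⟨(1 + 1 / (r₀ * (1 + θ - 1 / r₂ - 1 / r₁) - 1)).toNNReal * C,
    fun g₀ g₁ g₂ hg₀ hg₁ hg₂ hN₀ hN₁ hN₂ f hf K hK => ?_⟩
  have := (hC g₁ g₂ hg₁ hg₂ hN₁ hN₂ f hf K hK).mul (measurable_convMul hg₁ hg₂ hf) hg₀ h₀ hθ₀ hN₀
  convert this using 1
  rw [ENNReal.coe_mul]
  simp only [ENNReal.ofReal]
  ring

lemma exists_setIntegralBound_convMul_convMul (n : ℕ) {s₀ s₁ s₂ s₃ θ : ℝ} (h₀ : 1 < s₀)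
    (h₁ : 0 < s₁) (h₂ : 1 < s₂) (h₃ : 0 < s₃) (hθ₃ : 1 / s₃ < θ) (hθ₂ : θ - 1 / s₃ < 1 / s₂)
    (hθ₁ : 1 / s₁ < 1 + θ - 1 / s₃ - 1 / s₂)
    (hθ₀ : 1 + θ - 1 / s₃ - 1 / s₂ - 1 / s₁ < 1 / s₀) :
    ∃ C : ℝ≥0, ∀ (g₀ g₁ g₂ g₃ : (E n) → ℂ), Measurable g₀ → Measurable g₁ → Measurable g₂ →
      Measurable g₃ → weakLpNorm g₀ s₀ volume ≠ ∞ → weakLpNorm g₁ s₁ volume ≠ ∞ →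
      weakLpNorm g₂ s₂ volume ≠ ∞ → weakLpNorm g₃ s₃ volume ≠ ∞ →
      ∀ f, Measurable f → ∀ K, SetIntegralBound f θ K volume →
        SetIntegralBound (convMul g₀ g₁ (convMul g₂ g₃ f))
          (1 + (1 + θ - 1 / s₃ - 1 / s₂) - 1 / s₁ - 1 / s₀)
          (C * (weakLpNorm g₀ s₀ volume * weakLpNorm g₁ s₁ volume * weakLpNorm g₂ s₂ volume *
            weakLpNorm g₃ s₃ volume) * K) volume := by
  obtain ⟨C, hC⟩ := exists_setIntegralBound_convMul n h₂ h₃ hθ₃ hθ₂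
  obtain ⟨C', hC'⟩ := exists_setIntegralBound_convMul n h₀ h₁ hθ₁ hθ₀
  refine ⟨C' * C, fun g₀ g₁ g₂ g₃ hg₀ hg₁ hg₂ hg₃ hN₀ hN₁ hN₂ hN₃ f hf K hK => ?_⟩
  have := hC' g₀ g₁ hg₀ hg₁ hN₀ hN₁ _ (measurable_convMul hg₂ hg₃ hf) _
    (hC g₂ g₃ hg₂ hg₃ hN₂ hN₃ f hf K hK)
  convert this using 1
  rw [ENNReal.coe_mul]
  ring

/-! ### Complex convolutions and the positive operators that dominate them -/

lemma weakLpNorm_congr_ae {X : Type*} [MeasurableSpace X] {μ : Measure X} {f g : X → ℂ}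
    (h : f =ᵐ[μ] g) (q : ℝ) : weakLpNorm f q μ = weakLpNorm g q μ := by
  unfold weakLpNorm
  congr! 4 with t
  refine measure_congr ?_
  filter_upwards [h] with x hx
  exact congrArg (fun z : ℂ => (t : ℝ≥0∞) < ‖z‖ₑ) hx

lemma convRn_congr_ae {u u' v v' : (E n) → ℂ} (hu : u =ᵐ[volume] u') (hv : v =ᵐ[volume] v') :
    convRn u v = convRn u' v' :=
  convolution_congr _ hu hv

lemma ConvExistsAE.congr_ae {u u' v v' : (E n) → ℂ} (h : ConvExistsAE u v)
    (hu : u =ᵐ[volume] u') (hv : v =ᵐ[volume] v') : ConvExistsAE u' v' := by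
  filter_upwards [h] with x hx
  refine hx.congr ?_
  have hv' := (quasiMeasurePreserving_sub_left_of_right_invariant volume x).ae_eq_comp hv
  filter_upwards [hu, hv'] with t h1 h2
  simp only [Function.comp_apply] at h2
  rw [h1, h2]

lemma enorm_convRn_le (u v : (E n) → ℂ) (x : E n) :
    ‖convRn u v x‖ₑ ≤ enormConv volume u (fun y => ‖v y‖ₑ) x := by
  refine (enorm_integral_le_lintegral_enorm _).trans_eq ?_
  simp [enormConv]

lemma enorm_convRn_mul_le (u v w : (E n) → ℂ) (x : E n) :
    ‖convRn u (v * w) x‖ₑ ≤ convMul u v (fun y => ‖w y‖ₑ) x :=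
  (enorm_convRn_le _ _ x).trans_eq (by simp [convMul])

lemma measurable_convRn {u v : (E n) → ℂ} (hu : Measurable u) (hv : Measurable v) :
    Measurable (convRn u v) := by
  have : StronglyMeasurable fun z : (E n) × (E n) => u z.2 * v (z.1 - z.2) :=
    ((hu.comp measurable_snd).mul (hv.comp measurable_sub)).stronglyMeasurable
  exact this.integral_prod_right'.measurable

lemma convExistsAE_mul {u v w : (E n) → ℂ} (hu : Measurable u) (hv : Measurable v)
    (hw : Measurable w) (h : ∀ᵐ x, convMul u v (fun y => ‖w y‖ₑ) x < ∞) :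
    ConvExistsAE u (v * w) := by
  filter_upwards [h] with x hx
  refine ⟨?_, ?_⟩
  · exact (hu.mul ((hv.mul hw).comp (measurable_id.const_sub x))).aestronglyMeasurable
  · refine lt_of_eq_of_lt ?_ hx
    simp [convMul, enormConv]

lemma lintegral_enorm_rpow_eq_eLpNorm {f : (E n) → ℂ} {p : ℝ} (hp : 0 < p) :
    (∫⁻ x, ‖f x‖ₑ ^ p) ^ (1 / p) = eLpNorm f (ENNReal.ofReal p) volume := by
  rw [eLpNorm_eq_lintegral_rpow_enorm_toReal (by simpa using hp) (by simp),
    ENNReal.toReal_ofReal hp.le]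

/-- `ℝ≥0∞`-valued bounds for a dominating operator give the `L^p` to `L^q` statement. -/
lemma memLp_and_eLpNorm_le {F f : (E n) → ℂ} (hF : Measurable F) {U : (E n) → ℝ≥0∞}
    (hU : ∀ x, ‖F x‖ₑ ≤ U x) {p q : ℝ} (hp : 0 < p) (hq : 0 < q) {A : ℝ≥0∞} (hA : A ≠ ∞)
    (hf : eLpNorm f (ENNReal.ofReal p) volume ≠ ∞)
    (h : (∫⁻ x, U x ^ q) ^ (1 / q) ≤ A * (∫⁻ x, ‖f x‖ₑ ^ p) ^ (1 / p)) :
    MemLp F (ENNReal.ofReal q) volume ∧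
      eLpNorm F (ENNReal.ofReal q) volume ≤ A * eLpNorm f (ENNReal.ofReal p) volume := by
  have key : eLpNorm F (ENNReal.ofReal q) volume ≤ A * eLpNorm f (ENNReal.ofReal p) volume := by
    rw [← lintegral_enorm_rpow_eq_eLpNorm hq, ← lintegral_enorm_rpow_eq_eLpNorm hp]
    refine le_trans ?_ h
    gcongr with x
    exact hU x
  exact ⟨⟨hF.aestronglyMeasurable, key.trans_lt (ENNReal.mul_ne_top hA hf).lt_top⟩, key⟩

/-! ### The two estimates -/

lemma setIntegralBound_enorm_of_memLp {f : (E n) → ℂ} (hf : Measurable f) {p p' : ℝ}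
    (hpp' : p.HolderConjugate p') :
    SetIntegralBound (fun x => ‖f x‖ₑ) (1 / p') (eLpNorm f (ENNReal.ofReal p) volume) volume := by
  rw [← lintegral_enorm_rpow_eq_eLpNorm hpp'.pos]
  exact SetIntegralBound.of_lintegral_rpow hf.enorm hpp'

lemma lintegral_enorm_rpow_ne_top {f : (E n) → ℂ} {p : ℝ} (hp : 0 < p)
    (hf : MemLp f (ENNReal.ofReal p) volume) : ∫⁻ x, ‖f x‖ₑ ^ p ≠ ∞ := by
  have := hf.2
  rw [← lintegral_enorm_rpow_eq_eLpNorm hp, one_div,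
    ENNReal.rpow_lt_top_iff_of_pos (by positivity)] at this
  exact this.ne

/-- The bound for `g₀ (g₁ * (g₂ f))`, for measurable functions. -/
lemma exists_eLpNorm_mul_convRn_le (n : ℕ) {p q p' : ℝ} (hp : 1 < p) (hpq : p ≤ q)
    (hpp' : p.HolderConjugate p') {r₀ r₁ r₂ : ℝ} (h₀ : 1 < r₀) (h₁ : 1 < r₁) (h₂ : 1 < r₂)
    (hsum : 1 / q + 1 / p' = 1 / r₀ + 1 / r₁ + 1 / r₂) (hq : q < r₀) (hp' : p' < r₂) :
    ∃ C : ℝ≥0, ∀ g₀ g₁ g₂ f : (E n) → ℂ,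
      Measurable g₀ → Measurable g₁ → Measurable g₂ → Measurable f →
      weakLpNorm g₀ r₀ volume ≠ ∞ → weakLpNorm g₁ r₁ volume ≠ ∞ → weakLpNorm g₂ r₂ volume ≠ ∞ →
      MemLp f (ENNReal.ofReal p) volume →
      ConvExistsAE g₁ (g₂ * f) ∧
      MemLp (g₀ * convRn g₁ (g₂ * f)) (ENNReal.ofReal q) volume ∧
      eLpNorm (g₀ * convRn g₁ (g₂ * f)) (ENNReal.ofReal q) volume ≤
        C * (weakLpNorm g₀ r₀ volume * weakLpNorm g₁ r₁ volume * weakLpNorm g₂ r₂ volume) *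
          eLpNorm f (ENNReal.ofReal p) volume := by
  have hq1 : 1 < q := hp.trans_le hpq
  have hp0 : 0 < p := hpp'.pos
  have hp'0 : 0 < p' := hpp'.symm.pos
  have hq0 : 0 < q := by linarith
  have i₂ : 1 / r₂ < 1 / p' := one_div_lt_one_div_of_lt hp'0 hp'
  have i₀ : 1 / r₀ < 1 / q := one_div_lt_one_div_of_lt hq0 hq
  have iq : 1 / q < 1 := by rw [div_lt_one hq0]; exact hq1
  have j₀ : 0 < 1 / r₀ := by positivity
  have j₁ : 0 < 1 / r₁ := by positivity
  have j₂ : 0 < 1 / r₂ := by positivity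
  -- a `δ` so small that every strict inequality survives replacing `1 / p'` by `1 / p' ± δ`
  obtain ⟨δ, hδ, hδm⟩ : ∃ δ : ℝ, 0 < δ ∧
      δ < min (1 / p' - 1 / r₂) (min (1 / q - 1 / r₀) (1 - 1 / q)) :=
    exists_between (lt_min (by linarith) (lt_min (by linarith) (by linarith)))
  simp only [lt_min_iff] at hδm
  obtain ⟨d1, d2, d3⟩ := hδm
  obtain ⟨C, hC⟩ := exists_lintegral_rpow_le_of_setIntegralBound
    (volume : Measure (E n)) (volume : Measure (E n)) hpq hpp' hδ (by linarith) (by linarith) d3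
  obtain ⟨Cp, hCp⟩ := exists_setIntegralBound_mul_convMul n (r₀ := r₀) (r₁ := r₁) (r₂ := r₂)
    (θ := 1 / p' - δ) (by linarith) h₁ (by linarith) (by linarith) (by linarith) (by linarith)
  obtain ⟨Cm, hCm⟩ := exists_setIntegralBound_mul_convMul n (r₀ := r₀) (r₁ := r₁) (r₂ := r₂)
    (θ := 1 / p' - -δ) (by linarith) h₁ (by linarith) (by linarith) (by linarith) (by linarith)
  obtain ⟨C₁, hC₁⟩ := exists_setIntegralBound_convMul n (a := r₁) (b := r₂)
    (θ := 1 / p') h₁ (by linarith) i₂ (by linarith)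
  refine ⟨C * (Cp + Cm), fun g₀ g₁ g₂ f hg₀ hg₁ hg₂ hf hN₀ hN₁ hN₂ hfp => ?_⟩
  set N := weakLpNorm g₀ r₀ volume * weakLpNorm g₁ r₁ volume * weakLpNorm g₂ r₂ volume with hN
  have hNt : N ≠ ∞ := ENNReal.mul_ne_top (ENNReal.mul_ne_top hN₀ hN₁) hN₂
  constructor
  · refine convExistsAE_mul hg₁ hg₂ hf ?_
    refine (hC₁ g₁ g₂ hg₁ hg₂ hN₁ hN₂ _ hf.enorm _
      (setIntegralBound_enorm_of_memLp hf hpp')).ae_lt_top (measurable_convMul hg₁ hg₂ hf.enorm)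
      (by linarith) ?_
    exact ENNReal.mul_ne_top (ENNReal.mul_ne_top ENNReal.coe_ne_top
      (ENNReal.mul_ne_top hN₁ hN₂)) hfp.2.ne
  have key := hC (fun f x => ‖g₀ x‖ₑ * convMul g₁ g₂ f x) ((Cp + Cm : ℝ≥0) * N)
    (ENNReal.mul_ne_top ENNReal.coe_ne_top hNt)
    (fun f hf => hg₀.enorm.mul (measurable_convMul hg₁ hg₂ hf))
    (fun f f' hf hf' y => by
      rw [convMul_add hg₁ hg₂ hf, Pi.add_apply, mul_add])
    (by
      rintro s (rfl | rfl) f hf K hK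
      · have := (hCp g₀ g₁ g₂ hg₀ hg₁ hg₂ hN₀ hN₁ hN₂ f hf K hK).mono
          (K' := ((Cp + Cm : ℝ≥0) * N) * K) (by rw [← hN]; gcongr; exact le_self_add)
        convert this using 1
        linarith
      · have := (hCm g₀ g₁ g₂ hg₀ hg₁ hg₂ hN₀ hN₁ hN₂ f hf K hK).mono
          (K' := ((Cp + Cm : ℝ≥0) * N) * K) (by rw [← hN]; gcongr; exact le_add_self)
        convert this using 1
        linarith)
    (fun x => ‖f x‖ₑ) hf.enorm (fun x => by simp) (lintegral_enorm_rpow_ne_top hp0 hfp)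
  refine memLp_and_eLpNorm_le (hg₀.mul (measurable_convRn hg₁ (hg₂.mul hf))) (fun x => ?_) hp0 hq0
    (ENNReal.mul_ne_top ENNReal.coe_ne_top hNt) hfp.2.ne (key.trans_eq ?_)
  · rw [Pi.mul_apply, enorm_mul]
    gcongr
    exact enorm_convRn_mul_le _ _ _ x
  · rw [ENNReal.coe_mul]
    ring

/-- The bound for `g₀ * (g₁ (g₂ * (g₃ f)))`, for measurable functions. -/
lemma exists_eLpNorm_convRn_convRn_le (n : ℕ) {p q p' : ℝ} (hp : 1 < p) (hpq : p ≤ q)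
    (hpp' : p.HolderConjugate p') {s₀ s₁ s₂ s₃ : ℝ} (h₀ : 1 < s₀) (h₁ : 1 < s₁) (h₂ : 1 < s₂)
    (h₃ : 1 < s₃) (hsum : 1 + 1 / q + 1 / p' = 1 / s₀ + 1 / s₁ + 1 / s₂ + 1 / s₃)
    (hq : s₀ < q) (hp' : p' < s₃) (hs : 1 / p' < 1 / s₂ + 1 / s₃) :
    ∃ C : ℝ≥0, ∀ g₀ g₁ g₂ g₃ f : (E n) → ℂ,
      Measurable g₀ → Measurable g₁ → Measurable g₂ → Measurable g₃ → Measurable f →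
      weakLpNorm g₀ s₀ volume ≠ ∞ → weakLpNorm g₁ s₁ volume ≠ ∞ → weakLpNorm g₂ s₂ volume ≠ ∞ →
      weakLpNorm g₃ s₃ volume ≠ ∞ → MemLp f (ENNReal.ofReal p) volume →
      ConvExistsAE g₂ (g₃ * f) ∧
      ConvExistsAE g₀ (g₁ * convRn g₂ (g₃ * f)) ∧
      MemLp (convRn g₀ (g₁ * convRn g₂ (g₃ * f))) (ENNReal.ofReal q) volume ∧
      eLpNorm (convRn g₀ (g₁ * convRn g₂ (g₃ * f))) (ENNReal.ofReal q) volume ≤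
        C * (weakLpNorm g₀ s₀ volume * weakLpNorm g₁ s₁ volume * weakLpNorm g₂ s₂ volume *
          weakLpNorm g₃ s₃ volume) * eLpNorm f (ENNReal.ofReal p) volume := by
  have hq1 : 1 < q := hp.trans_le hpq
  have hp0 : 0 < p := hpp'.pos
  have hp'0 : 0 < p' := hpp'.symm.pos
  have hq0 : 0 < q := by linarith
  have i₃ : 1 / s₃ < 1 / p' := one_div_lt_one_div_of_lt hp'0 hp'
  have i₀ : 1 / q < 1 / s₀ := one_div_lt_one_div_of_lt (by linarith) hq
  have iq : 1 / q < 1 := by rw [div_lt_one hq0]; exact hq1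
  have iq0 : 0 < 1 / q := by positivity
  have j₁ : 0 < 1 / s₁ := by positivity
  have j₃ : 0 < 1 / s₃ := by positivity
  -- a `δ` so small that every strict inequality survives replacing `1 / p'` by `1 / p' ± δ`
  obtain ⟨δ, hδ, hδm⟩ : ∃ δ : ℝ, 0 < δ ∧
      δ < min (min (1 / p' - 1 / s₃) (1 / s₂ + 1 / s₃ - 1 / p'))
        (min (1 / s₀ - 1 / q) (min (1 / q) (1 - 1 / q))) :=
    exists_between (lt_min (lt_min (by linarith) (by linarith))
      (lt_min (by linarith) (lt_min iq0 (by linarith))))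
  simp only [lt_min_iff] at hδm
  obtain ⟨⟨d1, d2⟩, d3, d4, d5⟩ := hδm
  obtain ⟨C, hC⟩ := exists_lintegral_rpow_le_of_setIntegralBound
    (volume : Measure (E n)) (volume : Measure (E n)) hpq hpp' hδ (by linarith) d4 d5
  obtain ⟨Cp, hCp⟩ := exists_setIntegralBound_convMul_convMul n (s₀ := s₀) (s₁ := s₁) (s₂ := s₂)
    (s₃ := s₃) (θ := 1 / p' - δ) h₀ (by linarith) h₂ (by linarith) (by linarith) (by linarith)
    (by linarith) (by linarith)
  obtain ⟨Cm, hCm⟩ := exists_setIntegralBound_convMul_convMul n (s₀ := s₀) (s₁ := s₁) (s₂ := s₂)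
    (s₃ := s₃) (θ := 1 / p' - -δ) h₀ (by linarith) h₂ (by linarith) (by linarith) (by linarith)
    (by linarith) (by linarith)
  obtain ⟨C₁, hC₁⟩ := exists_setIntegralBound_convMul n (a := s₂) (b := s₃)
    (θ := 1 / p') h₂ (by linarith) i₃ (by linarith)
  obtain ⟨C₂, hC₂⟩ := exists_setIntegralBound_convMul_convMul n (s₀ := s₀) (s₁ := s₁) (s₂ := s₂)
    (s₃ := s₃) (θ := 1 / p') h₀ (by linarith) h₂ (by linarith) (by linarith) (by linarith)
    (by linarith) (by linarith)
  refine ⟨C * (Cp + Cm), fun g₀ g₁ g₂ g₃ f hg₀ hg₁ hg₂ hg₃ hf hN₀ hN₁ hN₂ hN₃ hfp => ?_⟩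
  set N := weakLpNorm g₀ s₀ volume * weakLpNorm g₁ s₁ volume * weakLpNorm g₂ s₂ volume *
    weakLpNorm g₃ s₃ volume with hN
  have hNt : N ≠ ∞ := ENNReal.mul_ne_top (ENNReal.mul_ne_top (ENNReal.mul_ne_top hN₀ hN₁) hN₂) hN₃
  have hw : Measurable (convRn g₂ (g₃ * f)) := measurable_convRn hg₂ (hg₃.mul hf)
  have hbf := setIntegralBound_enorm_of_memLp hf hpp'
  have hle : ∀ x, convMul g₀ g₁ (fun y => ‖convRn g₂ (g₃ * f) y‖ₑ) x ≤
      convMul g₀ g₁ (convMul g₂ g₃ fun y => ‖f y‖ₑ) x :=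
    convMul_mono fun y => enorm_convRn_mul_le _ _ _ y
  refine ⟨?_, ?_, ?_⟩
  · refine convExistsAE_mul hg₂ hg₃ hf ?_
    refine (hC₁ g₂ g₃ hg₂ hg₃ hN₂ hN₃ _ hf.enorm _ hbf).ae_lt_top
      (measurable_convMul hg₂ hg₃ hf.enorm) (by linarith) ?_
    exact ENNReal.mul_ne_top (ENNReal.mul_ne_top ENNReal.coe_ne_top
      (ENNReal.mul_ne_top hN₂ hN₃)) hfp.2.ne
  · refine convExistsAE_mul hg₀ hg₁ hw ?_
    have := (hC₂ g₀ g₁ g₂ g₃ hg₀ hg₁ hg₂ hg₃ hN₀ hN₁ hN₂ hN₃ _ hf.enorm _ hbf).ae_lt_top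
      (measurable_convMul hg₀ hg₁ (measurable_convMul hg₂ hg₃ hf.enorm)) (by linarith)
      (ENNReal.mul_ne_top (ENNReal.mul_ne_top ENNReal.coe_ne_top hNt) hfp.2.ne)
    filter_upwards [this] with x hx
    exact (hle x).trans_lt hx
  have key := hC (fun f => convMul g₀ g₁ (convMul g₂ g₃ f)) ((Cp + Cm : ℝ≥0) * N)
    (ENNReal.mul_ne_top ENNReal.coe_ne_top hNt)
    (fun f hf => measurable_convMul hg₀ hg₁ (measurable_convMul hg₂ hg₃ hf))
    (fun f f' hf hf' y => by
      rw [convMul_add hg₂ hg₃ hf, convMul_add hg₀ hg₁ (measurable_convMul hg₂ hg₃ hf),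
        Pi.add_apply])
    (by
      rintro s (rfl | rfl) f hf K hK
      · have := (hCp g₀ g₁ g₂ g₃ hg₀ hg₁ hg₂ hg₃ hN₀ hN₁ hN₂ hN₃ f hf K hK).mono
          (K' := ((Cp + Cm : ℝ≥0) * N) * K) (by rw [← hN]; gcongr; exact le_self_add)
        convert this using 1
        linarith
      · have := (hCm g₀ g₁ g₂ g₃ hg₀ hg₁ hg₂ hg₃ hN₀ hN₁ hN₂ hN₃ f hf K hK).mono
          (K' := ((Cp + Cm : ℝ≥0) * N) * K) (by rw [← hN]; gcongr; exact le_add_self)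
        convert this using 1
        linarith)
    (fun x => ‖f x‖ₑ) hf.enorm (fun x => by simp) (lintegral_enorm_rpow_ne_top hp0 hfp)
  refine memLp_and_eLpNorm_le (measurable_convRn hg₀ (hg₁.mul hw))
    (fun x => (enorm_convRn_mul_le _ _ _ x).trans (hle x)) hp0 hq0
    (ENNReal.mul_ne_top ENNReal.coe_ne_top hNt) hfp.2.ne (key.trans_eq ?_)
  rw [ENNReal.coe_mul]
  ring

lemma MemWeakLp.exists_measurable {X : Type*} [MeasurableSpace X] {μ : Measure X} {g : X → ℂ}
    {r : ℝ} (h : MemWeakLp g r μ) :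
    ∃ g', Measurable g' ∧ g =ᵐ[μ] g' ∧ weakLpNorm g r μ = weakLpNorm g' r μ ∧
      weakLpNorm g' r μ ≠ ∞ :=
  ⟨h.1.mk g, h.1.stronglyMeasurable_mk.measurable, h.1.ae_eq_mk,
    weakLpNorm_congr_ae h.1.ae_eq_mk r, by
      rw [← weakLpNorm_congr_ae h.1.ae_eq_mk r]; exact h.2.ne⟩

end Operators

theorem theorem7 (n : ℕ) (hn : 1 ≤ n) (p q p' : ℝ) (hp : 1 < p) (hpq : p ≤ q)
    (hpp' : p.HolderConjugate p') :
    (∀ r : Fin 3 → ℝ, (∀ k, 1 < r k) → 1 / q + 1 / p' = ∑ k, 1 / r k →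
      q < r 0 → p' < r 2 →
      ∃ C : ℝ≥0, ∀ (g : Fin 3 → EuclideanSpace ℝ (Fin n) → ℂ)
        (f : EuclideanSpace ℝ (Fin n) → ℂ),
        (∀ k, MemWeakLp (g k) (r k) volume) → MemLp f (ENNReal.ofReal p) volume →
        ConvExistsAE (g 1) (g 2 * f) ∧
        MemLp (g 0 * convRn (g 1) (g 2 * f)) (ENNReal.ofReal q) volume ∧
        eLpNorm (g 0 * convRn (g 1) (g 2 * f)) (ENNReal.ofReal q) volume ≤
          C * (∏ k, weakLpNorm (g k) (r k) volume) * eLpNorm f (ENNReal.ofReal p) volume) ∧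
    (∀ s : Fin 4 → ℝ, (∀ k, 1 < s k) → 1 + 1 / q + 1 / p' = ∑ k, 1 / s k →
      s 0 < q → p' < s 3 → 1 / p' < 1 / s 2 + 1 / s 3 →
      ∃ C : ℝ≥0, ∀ (h : Fin 4 → EuclideanSpace ℝ (Fin n) → ℂ)
        (f : EuclideanSpace ℝ (Fin n) → ℂ),
        (∀ k, MemWeakLp (h k) (s k) volume) → MemLp f (ENNReal.ofReal p) volume →
        ConvExistsAE (h 2) (h 3 * f) ∧
        ConvExistsAE (h 0) (h 1 * convRn (h 2) (h 3 * f)) ∧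
        MemLp (convRn (h 0) (h 1 * convRn (h 2) (h 3 * f))) (ENNReal.ofReal q) volume ∧
        eLpNorm (convRn (h 0) (h 1 * convRn (h 2) (h 3 * f))) (ENNReal.ofReal q) volume ≤
          C * (∏ k, weakLpNorm (h k) (s k) volume) * eLpNorm f (ENNReal.ofReal p) volume) := by
  constructor
  · intro r hr hsum hq hp'
    rw [Fin.sum_univ_three] at hsum
    obtain ⟨C, hC⟩ := exists_eLpNorm_mul_convRn_le n hp hpq hpp' (hr 0) (hr 1) (hr 2) hsum hq hp'
    refine ⟨C, fun g f hg hf => ?_⟩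
    choose g' hm hae hN hNt using fun k => (hg k).exists_measurable
    obtain ⟨f', hfm, hfae⟩ := hf.1.aemeasurable
    obtain ⟨h1, h2, h3⟩ := hC (g' 0) (g' 1) (g' 2) f' (hm 0) (hm 1) (hm 2)
      hfm (hNt 0) (hNt 1) (hNt 2) (hf.ae_eq hfae)
    have e2 := (hae 2).mul hfae
    have e0 := (hae 0).mul (ae_eq_refl (convRn (g 1) (g 2 * f)))
    rw [convRn_congr_ae (hae 1) e2] at e0 ⊢
    rw [Fin.prod_univ_three, hN, hN, hN, eLpNorm_congr_ae e0, eLpNorm_congr_ae hfae]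
    exact ⟨h1.congr_ae (hae 1).symm e2.symm, h2.ae_eq e0.symm, h3⟩
  · intro s hs hsum hq hp' hs23
    rw [Fin.sum_univ_four] at hsum
    obtain ⟨C, hC⟩ := exists_eLpNorm_convRn_convRn_le n hp hpq hpp' (hs 0) (hs 1) (hs 2) (hs 3)
      hsum hq hp' hs23
    refine ⟨C, fun g f hg hf => ?_⟩
    choose g' hm hae hN hNt using fun k => (hg k).exists_measurable
    obtain ⟨f', hfm, hfae⟩ := hf.1.aemeasurable
    obtain ⟨h1, h2, h3, h4⟩ := hC (g' 0) (g' 1) (g' 2) (g' 3) f' (hm 0) (hm 1) (hm 2)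
      (hm 3) hfm (hNt 0) (hNt 1) (hNt 2) (hNt 3) (hf.ae_eq hfae)
    have e3 := (hae 3).mul hfae
    have e1 := (hae 1).mul (ae_eq_refl (convRn (g 2) (g 3 * f)))
    rw [convRn_congr_ae (hae 2) e3] at e1 ⊢
    rw [convRn_congr_ae (hae 0) e1, Fin.prod_univ_four, hN, hN, hN, hN, eLpNorm_congr_ae hfae]
    exact ⟨h1.congr_ae (hae 2).symm e3.symm, h2.congr_ae (hae 0).symm e1.symm, h3, h4⟩
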